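/- **Theorem (Local boundedness).** Let $d\ge 1$, $p>2$, let $\Omega_1\subset\mathbb{R}^d$ be open and suppose that $\Gamma:=\partial\Omega_1$ is a $(d-1)$-dimensional surface of class $C^1$. Let $R>0$ and $M\ge 0$. There is a constant $C>0$, depending only on $d$, $p$, $\Omega_1$ (that is, on the interface), $R$ and $M$, such that the following holds. Let $\Omega\subset\mathbb{R}^d$ be a bounded domain with $\Omega_1\Subset\Omega$, let $f\in L^\infty(\Gamma)$ with $\|f\|_{L^\infty(\Gamma)}=M$, and let $u\in W^{1,p}_0(\Omega)$ be a weak solution of the transmission problem $-\operatorname{div}(|Du|^{p-2}Du)=f\,d\mathcal{H}^{d-1}\big|_\Gamma$ in $\Omega$, $u=0$ on $\partial\Omega$, that is, $$\int_\Omega |Du|^{p-2}Du\cdot Dv\,dx=\int_\Gamma f\,v\,d\mathcal{H}^{d-1}\qquad\text{for all }v\in W^{1,p}_0(\Omega),$$ where $W^{1,p}_0(\Omega)$ is the closure of $C_c^\infty(\Omega)$ in $W^{1,p}(\Omega)$ and $v$ on $\Gamma$ is understood in the sense of traces. Then for every ball $B_R=B_R(x_0)\Subset\Omega$, with $B_{R/2}=B_{R/2}(x_0)$,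 $$\|u\|_{L^\infty(B_{R/2})}\le C R^{-\frac dp}\Big(\|u\|_{L^p(B_R)}+R^{\frac dp+1}\|f\|_{L^\infty(\Gamma)}\Big)$$ and $$\|Du\|_{L^p(B_{R/2})}\le C R^{-1}\Big(\|u\|_{L^p(B_R)}+R^{\frac dp+1}\|f\|_{L^\infty(\Gamma)}\Big).$$ -/

import Mathlib

open MeasureTheory Filter Topology Set Metric
open scoped ENNReal NNReal Gradient ContDiff

namespace Transmission

/-- Euclidean space `ℝ^d`. -/
abbrev E (d : ℕ) : Type := EuclideanSpace ℝ (Fin d)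

/-- `φ ∈ C_c^∞(Ω)`. -/
structure IsTestFunction {d : ℕ} (Ω : Set (E d)) (φ : E d → ℝ) : Prop where
  smooth : ContDiff ℝ ∞ φ
  compact : HasCompactSupport φ
  subset : tsupport φ ⊆ Ω

/-- `Du` is the weak gradient of `u` on `Ω`:
`∫_Ω u ∇φ = - ∫_Ω φ Du` for all `φ ∈ C_c^∞(Ω)`.
It is only used together with `u, Du ∈ L^p(Ω)`, `p ≥ 1`, so that both integrals converge. -/
def HasWeakGradient {d : ℕ} (Ω : Set (E d)) (u : E d → ℝ) (Du : E d → E d) : Prop :=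
  ∀ φ : E d → ℝ, IsTestFunction Ω φ →
    ∫ x in Ω, u x • ∇ φ x = - ∫ x in Ω, φ x • Du x

/-- `u ∈ W^{1,p}(Ω)` with weak gradient `Du`. -/
structure MemW1p {d : ℕ} (Ω : Set (E d)) (p : ℝ) (u : E d → ℝ) (Du : E d → E d) : Prop where
  memLp : MemLp u (ENNReal.ofReal p) (volume.restrict Ω)
  memLp_grad : MemLp Du (ENNReal.ofReal p) (volume.restrict Ω)
  weak : HasWeakGradient Ω u Du

/-- The sequence `φ n ∈ C_c^∞(Ω)` converges to `u` (with gradient `Du`) in the norm of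
`W^{1,p}(Ω)`. -/
structure TestApprox {d : ℕ} (Ω : Set (E d)) (p : ℝ) (u : E d → ℝ) (Du : E d → E d)
    (φ : ℕ → E d → ℝ) : Prop where
  test : ∀ n, IsTestFunction Ω (φ n)
  tendsto : Tendsto (fun n => eLpNorm (fun x => u x - φ n x) (ENNReal.ofReal p)
    (volume.restrict Ω)) atTop (𝓝 0)
  tendsto_grad : Tendsto (fun n => eLpNorm (fun x => Du x - ∇ (φ n) x) (ENNReal.ofReal p)
    (volume.restrict Ω)) atTop (𝓝 0)

/-- `u ∈ W_0^{1,p}(Ω)` with weak gradient `Du`: `W_0^{1,p}(Ω)` is the closure of `C_c^∞(Ω)`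
in `W^{1,p}(Ω)`. -/
def MemW01p {d : ℕ} (Ω : Set (E d)) (p : ℝ) (u : E d → ℝ) (Du : E d → E d) : Prop :=
  MemW1p Ω p u Du ∧ ∃ φ : ℕ → E d → ℝ, TestApprox Ω p u Du φ

/-- `Γ` is an embedded `(d-1)`-dimensional surface of class `C^1`: near each of its points it is
the zero set of a `C^1` function with non-vanishing differential. -/
def IsC1Hypersurface {d : ℕ} (Γ : Set (E d)) : Prop :=
  ∀ x ∈ Γ, ∃ ρ : E d → ℝ, ContDiffAt ℝ 1 ρ x ∧ fderiv ℝ ρ x ≠ 0 ∧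
    ∀ᶠ y in 𝓝 x, (y ∈ Γ ↔ ρ y = 0)

/-- The surface measure `H^{d-1}` restricted to `Γ` (`d ≥ 1`). The Hausdorff measure is normalized
so that it agrees with Lebesgue measure on `ℝ^{d-1}`. -/
noncomputable def surfaceMeasure {d : ℕ} (Γ : Set (E d)) : Measure (E d) :=
  (Measure.euclideanHausdorffMeasure (d - 1)).restrict Γ

/-- `τ` is the trace on `Γ` of the function `v ∈ W_0^{1,p}(Ω)` with gradient `Dv`: the trace
operator is the extension by continuity, from `W^{1,p}` to `L^p(Γ)`, of the restriction map
`φ ↦ φ|_Γ` on `C_c^∞(Ω)`. -/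
def IsTrace {d : ℕ} (Ω Γ : Set (E d)) (p : ℝ) (v : E d → ℝ) (Dv : E d → E d)
    (τ : E d → ℝ) : Prop :=
  MemLp τ (ENNReal.ofReal p) (surfaceMeasure Γ) ∧
  ∃ φ : ℕ → E d → ℝ, TestApprox Ω p v Dv φ ∧
    Tendsto (fun n => eLpNorm (fun x => τ x - φ n x) (ENNReal.ofReal p) (surfaceMeasure Γ))
      atTop (𝓝 0)

/-- The vector field `ξ ↦ (g(|ξ|) / |ξ|) ξ`. -/
noncomputable def flux {d : ℕ} (g : ℝ → ℝ) (ξ : E d) : E d := (g ‖ξ‖ / ‖ξ‖) • ξ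

/-- `u`, with weak gradient `Du`, is a weak solution of the transmission problem with
`g(t) = t^{p-1}`, interface `Γ` and interface datum `f`: `u ∈ W_0^{1,p}(Ω)` and
`∫_Ω (g(|Du|)/|Du|) Du · Dv dx = ∫_Γ f v dH^{d-1}` for all `v ∈ W_0^{1,p}(Ω)`, where `v` on `Γ`
is understood as the trace of `v`. -/
def IsWeakSolution {d : ℕ} (Ω Γ : Set (E d)) (p : ℝ) (f : E d → ℝ)
    (u : E d → ℝ) (Du : E d → E d) : Prop :=
  MemW01p Ω p u Du ∧
  ∀ (v : E d → ℝ) (Dv : E d → E d) (τ : E d → ℝ), MemW01p Ω p v Dv → IsTrace Ω Γ p v Dv τ →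
    ∫ x in Ω, inner ℝ (flux (fun t : ℝ => t ^ (p - 1)) (Du x)) (Dv x) =
      ∫ x, f x * τ x ∂(surfaceMeasure Γ)

end Transmission

/-! The surface datum is treated as a bounded functional on functions of bounded variation. A
compact C^1 hypersurface satisfies ∫_Γ |φ| ≤ C ∫ |∇φ| for compactly supported C^1 functions
(`IsC1Hypersurface.trace_inequality`), so a weak solution satisfies |∫ |Du|^{p-2} Du · ∇φ| ≤ K ∫
|∇φ| with K = MC (`IsWeakSolution.abs_integral_flux_le`). This is recorded in `FluxBounded`;
afterwards Γ and f are seen only through K. The estimate extends by density to the functions w =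
ζψ(u), with ψ the identity or t ↦ (t - k)_+.

Young's inequality K t ≤ t^p/4 + κ absorbs the datum into the energy. The price is the constant κ on
the set where the truncation is active, so `FluxBounded.caccioppoli` carries the extra term κ |{u >
k} ∩ B|, which has the size De Giorgi's method tolerates. Combined with a Poincaré inequality that
gains a power of the measure of the support (`poincare`) and with Chebyshev's inequality, it gives a
superlinear recursion for the level-set integrals ∫_{B_r} (u - k)_+^p (`exists_deGiorgi_const`).
Along levels rising to k and radii shrinking to R/2 these integrals tend to zero
(`exists_threshold`), so u ≤ k on B_{R/2}; the same argument applied to -u bounds |u|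
(`exists_local_const`). The gradient estimate is the Caccioppoli inequality without truncation
(`exists_gradient_const`).

The final constant may depend on R and M, so κ is simply compared with the p-th power of R^{d/p+1}
M. -/

namespace Transmission

/-! ### Coordinate slices, Lipschitz graphs and the trace inequality in L^1. -/

/-- The point of `ℝ^(n+1)` with `i`-th coordinate `t` and remaining coordinates `y`. -/
def slice {n : ℕ} (i : Fin (n + 1)) (y : E n) (t : ℝ) : E (n + 1) :=
  WithLp.toLp 2 (i.insertNth t y.ofLp)

theorem slice_eq {n : ℕ} (i : Fin (n + 1)) (y : E n) (t : ℝ) :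
    slice i y t = slice i y 0 + t • EuclideanSpace.single i (1 : ℝ) := by
  ext j
  refine Fin.succAboveCases i ?_ (fun k => ?_) j <;> simp [slice]

theorem hasDerivAt_slice {n : ℕ} (i : Fin (n + 1)) (y : E n) (t : ℝ) :
    HasDerivAt (slice i y) (EuclideanSpace.single i (1 : ℝ)) t := by
  have h : slice i y = fun t => slice i y 0 + t • EuclideanSpace.single i (1 : ℝ) :=
    funext (slice_eq i y)
  rw [h]
  simpa using ((hasDerivAt_id t).smul_const (EuclideanSpace.single i (1 : ℝ))).const_add
    (slice i y 0)

theorem contDiff_slice {n : ℕ} (i : Fin (n + 1)) (y : E n) : ContDiff ℝ 1 (slice i y) := by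
  have h : slice i y = fun t => slice i y 0 + t • EuclideanSpace.single i (1 : ℝ) :=
    funext (slice_eq i y)
  rw [h]
  fun_prop

theorem isClosedEmbedding_slice {n : ℕ} (i : Fin (n + 1)) (y : E n) :
    IsClosedEmbedding (slice i y) := by
  refine Isometry.isClosedEmbedding (Isometry.of_dist_eq fun s t => ?_)
  rw [slice_eq i y s, slice_eq i y t, dist_add_left, dist_eq_norm, ← sub_smul, norm_smul]
  simp [Real.dist_eq]

theorem lintegral_slice {n : ℕ} (i : Fin (n + 1)) {F : E (n + 1) → ℝ≥0∞} (hF : Measurable F) :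
    ∫⁻ y : E n, ∫⁻ t, F (slice i y t) = ∫⁻ x, F x := by
  have h1 := (PiLp.volume_preserving_toLp (Fin (n + 1))).lintegral_comp hF
  have h2 := (volume_preserving_piFinSuccAbove (fun _ : Fin (n + 1) => ℝ) i).symm.lintegral_comp
    (hF.comp (WithLp.measurable_toLp 2 _))
  have hm : Measurable (fun q : ℝ × (Fin n → ℝ) =>
      F (WithLp.toLp 2 ((MeasurableEquiv.piFinSuccAbove (fun _ : Fin (n + 1) => ℝ) i).symm q))) :=
    (hF.comp (WithLp.measurable_toLp 2 _)).comp (MeasurableEquiv.measurable _)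
  have h3 := lintegral_prod_symm' (μ := (volume : Measure ℝ))
    (ν := (volume : Measure (Fin n → ℝ))) _ hm
  have h4 := (PiLp.volume_preserving_ofLp (Fin n)).lintegral_comp (hm.lintegral_prod_left'
    (μ := (volume : Measure ℝ)))
  exact (h4.trans h3.symm).trans (h2.trans h1)

/-- Fundamental theorem of calculus along a coordinate line, from infinity. The bound is independent
of `t`, so the height of a graph over `y` can be inserted for `t`. -/
theorem enorm_slice_le {n : ℕ} (i : Fin (n + 1)) {φ : E (n + 1) → ℝ} (hφ : ContDiff ℝ 1 φ)
    (hc : HasCompactSupport φ) (y : E n) (t : ℝ) :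
    ‖φ (slice i y t)‖ₑ ≤ ∫⁻ s, ‖fderiv ℝ φ (slice i y s)‖ₑ := by
  have h := HasCompactSupport.enorm_le_lintegral_Ici_deriv (hφ.comp (contDiff_slice i y))
    (hc.comp_isClosedEmbedding (isClosedEmbedding_slice i y)) t
  refine h.trans ((setLIntegral_le_lintegral _ _).trans (lintegral_mono fun s => ?_))
  have hd := ((hφ.differentiable one_ne_zero).differentiableAt.hasFDerivAt
    (x := slice i y s)).comp_hasDerivAt s (hasDerivAt_slice i y s)
  rw [hd.deriv]
  refine (ContinuousLinearMap.le_opENorm _ _).trans ?_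
  simp [enorm_eq_nnnorm]

/-- A function on `ℝ^(n+1)` restricted to a Lipschitz graph. -/
theorem lintegral_range_le {n : ℕ} {G : E n → E (n + 1)} {K : ℝ≥0} (hG : LipschitzWith K G)
    {F : E (n + 1) → ℝ≥0∞} (hF : Measurable F) :
    ∫⁻ x in range G, F x ∂(Measure.euclideanHausdorffMeasure n : Measure (E (n + 1))) ≤
      (K : ℝ≥0∞) ^ n * ∫⁻ y, F (G y) := by
  have hGm : Measurable G := hG.continuous.measurable
  have key : (Measure.euclideanHausdorffMeasure n : Measure (E (n + 1))).restrict (range G) ≤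
      (K : ℝ≥0∞) ^ n • (volume : Measure (E n)).map G := by
    refine Measure.le_iff.2 fun A hA => ?_
    rw [Measure.restrict_apply hA, Measure.smul_apply, Measure.map_apply hGm hA, smul_eq_mul,
      ← image_preimage_eq_inter_range, ← EuclideanSpace.euclideanHausdorffMeasure_eq_volume n,
      Measure.euclideanHausdorffMeasure_def, Measure.euclideanHausdorffMeasure_def]
    have h := hG.hausdorffMeasure_image_le (d := n) n.cast_nonneg (G ⁻¹' A)
    rw [ENNReal.rpow_natCast] at h
    simp only [Measure.smul_apply, ENNReal.smul_def, smul_eq_mul]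
    calc _ ≤ _ := mul_le_mul_right h _
      _ = _ := by ring
  calc _ ≤ ∫⁻ x, F x ∂((K : ℝ≥0∞) ^ n • (volume : Measure (E n)).map G) :=
        lintegral_mono' key le_rfl
    _ = _ := by rw [lintegral_smul_measure, lintegral_map hF hGm, smul_eq_mul]

theorem lipschitzWith_slice {n : ℕ} (i : Fin (n + 1)) {γ : E n → ℝ} {L : ℝ≥0}
    (hγ : LipschitzWith L γ) : ∃ K : ℝ≥0, LipschitzWith K fun y => slice i y (γ y) := by
  refine ⟨_, (PiLp.lipschitzWith_toLp 2 (fun _ : Fin (n + 1) => ℝ)).comp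
    (LipschitzWith.of_dist_le_mul (K := max L 1) fun y z => ?_)⟩
  refine (dist_pi_le_iff (by positivity)).2 fun j => ?_
  refine Fin.succAboveCases i ?_ (fun k => ?_) j
  · simpa using (hγ.dist_le_mul y z).trans
      (mul_le_mul_of_nonneg_right (le_max_left _ _) dist_nonneg)
  · simp only [Fin.insertNth_apply_succAbove]
    have := (PiLp.lipschitzWith_ofLp 2 (fun _ : Fin n => ℝ)).dist_le_mul y z
    rw [NNReal.coe_one, one_mul] at this
    refine ((dist_le_pi_dist y.ofLp z.ofLp k).trans this).trans ?_
    exact le_mul_of_one_le_left dist_nonneg (by simp)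

/-- Taking `t = γ y` in `enorm_slice_le` and integrating in `y`, Tonelli recovers the full integral
of the derivative. The constant is only the factor by which the Lipschitz parametrization can
enlarge area. -/
theorem trace_graph {n : ℕ} (i : Fin (n + 1)) {γ : E n → ℝ} {L : ℝ≥0} (hγ : LipschitzWith L γ) :
    ∃ C : ℝ≥0, ∀ φ : E (n + 1) → ℝ, ContDiff ℝ 1 φ → HasCompactSupport φ →
      ∫⁻ x in range (fun y => slice i y (γ y)), ‖φ x‖ₑ
        ∂(Measure.euclideanHausdorffMeasure n : Measure (E (n + 1))) ≤
        C * ∫⁻ x, ‖fderiv ℝ φ x‖ₑ := by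
  obtain ⟨K, hK⟩ := lipschitzWith_slice i hγ
  refine ⟨K ^ n, fun φ hφ hc => ?_⟩
  refine (lintegral_range_le hK hφ.continuous.enorm.measurable).trans ?_
  rw [← lintegral_slice i (hφ.continuous_fderiv one_ne_zero).enorm.measurable]
  push_cast
  gcongr with y
  exact enorm_slice_le i hφ hc y _

/-- Removal of the `i`-th coordinate. -/
def dropCoord {n : ℕ} (i : Fin (n + 1)) (x : E (n + 1)) : E n :=
  WithLp.toLp 2 (i.removeNth x.ofLp)

theorem slice_dropCoord {n : ℕ} (i : Fin (n + 1)) (x : E (n + 1)) :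
    slice i (dropCoord i x) (x i) = x := by
  ext j
  simp [slice, dropCoord]

theorem norm_slice_zero {n : ℕ} (i : Fin (n + 1)) (y : E n) : ‖slice i y 0‖ = ‖y‖ := by
  rw [EuclideanSpace.norm_eq, EuclideanSpace.norm_eq, Fin.sum_univ_succAbove _ i]
  simp [slice]

theorem dropCoord_sub {n : ℕ} (i : Fin (n + 1)) (x y : E (n + 1)) :
    dropCoord i (x - y) = dropCoord i x - dropCoord i y := rfl

/-- A `C^1` hypersurface is locally contained in the graph of a Lipschitz function over a
coordinate hyperplane. -/
theorem IsC1Hypersurface.exists_graph {n : ℕ} {Γ : Set (E (n + 1))} (hΓ : IsC1Hypersurface Γ)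
    {x : E (n + 1)} (hx : x ∈ Γ) :
    ∃ (i : Fin (n + 1)) (γ : E n → ℝ) (L : ℝ≥0), LipschitzWith L γ ∧
      ∀ᶠ y in 𝓝[Γ] x, y ∈ range (fun z => slice i z (γ z)) := by
  obtain ⟨ρ, hρ, hne, hev⟩ := hΓ x hx
  obtain ⟨i, hi⟩ : ∃ i, fderiv ℝ ρ x (EuclideanSpace.single i (1 : ℝ)) ≠ 0 := by
    by_contra! h
    refine hne (ContinuousLinearMap.coe_injective
      ((EuclideanSpace.basisFun (Fin (n + 1)) ℝ).toBasis.ext fun i => ?_))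
    simpa using h i
  set T := fderiv ℝ ρ x with hT
  set a := T (EuclideanSpace.single i (1 : ℝ)) with ha
  have ha0 : 0 < |a| := abs_pos.2 hi
  have hs : HasStrictFDerivAt ρ T x := hρ.hasStrictFDerivAt one_ne_zero
  -- Strict differentiability compares two arbitrary nearby points. On Γ both values of `ρ` vanish,
  -- so `T (y - z)` is at most `|a| / 2 * ‖y - z‖`.
  have hlo := (hasStrictFDerivAt_iff_isLittleO.1 hs).def (c := |a| / 2) (by positivity)
  rw [nhds_prod_eq] at hlo
  obtain ⟨U, hU, hUlo⟩ := Filter.mem_prod_same_iff.1 hlo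
  set S : Set (E (n + 1)) := {y | y ∈ U ∧ (y ∈ Γ ↔ ρ y = 0)} ∩ Γ with hS
  -- With t = y i - z i and v the difference of the other coordinates, |a||t| ≤ ‖T‖‖v‖ + (|a|/2)(‖v‖
  -- + |t|); solving for |t| gives this slope.
  set L : ℝ := (‖T‖ + |a| / 2) / (|a| / 2) with hL
  have hLip : ∀ y ∈ S, ∀ z ∈ S, |y i - z i| ≤ L * ‖dropCoord i y - dropCoord i z‖ := by
    rintro y ⟨⟨hyU, hy⟩, hyΓ⟩ z ⟨⟨hzU, hz⟩, hzΓ⟩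
    have h := hUlo (mk_mem_prod hyU hzU)
    simp only [mem_ofPred_eq, hy.1 hyΓ, hz.1 hzΓ, sub_self, zero_sub, norm_neg] at h
    set v := dropCoord i y - dropCoord i z with hv
    have hw : y - z = slice i v 0 + (y i - z i) • EuclideanSpace.single i (1 : ℝ) := by
      conv_lhs => rw [← slice_dropCoord i (y - z), slice_eq, dropCoord_sub]
      rfl
    have h1 : T (y - z) = T (slice i v 0) + (y i - z i) * a := by
      rw [hw, map_add, map_smul, smul_eq_mul]
    have h2 : ‖T (slice i v 0)‖ ≤ ‖T‖ * ‖v‖ := by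
      simpa [norm_slice_zero] using T.le_opNorm (slice i v 0)
    have h3 : ‖y - z‖ ≤ ‖v‖ + |y i - z i| := by
      rw [hw]
      refine (norm_add_le _ _).trans ?_
      rw [norm_slice_zero, norm_smul]
      simp
    have h4 : |y i - z i| * |a| ≤ ‖T (y - z)‖ + ‖T (slice i v 0)‖ := by
      rw [← abs_mul, ← Real.norm_eq_abs]
      have : (y i - z i) * a = T (y - z) - T (slice i v 0) := by rw [h1]; ring
      rw [this]
      exact norm_sub_le _ _
    have h5 : |a| / 2 * ‖y - z‖ ≤ |a| / 2 * (‖v‖ + |y i - z i|) := by gcongr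
    rw [hL, div_mul_eq_mul_div, le_div_iff₀ (by positivity)]
    nlinarith
  have hinj : InjOn (dropCoord i) S := by
    intro y hy z hz hyz
    have h := hLip y hy z hz
    rw [hyz, sub_self, norm_zero, mul_zero] at h
    rw [← slice_dropCoord i y, ← slice_dropCoord i z, hyz,
      sub_eq_zero.1 (abs_eq_zero.1 (le_antisymm h (abs_nonneg _)))]
  have hLip' : LipschitzOnWith L.toNNReal
      (fun w => Function.invFunOn (dropCoord i) S w i) (dropCoord i '' S) := by
    refine LipschitzOnWith.of_dist_le_mul ?_
    rintro _ ⟨y, hy, rfl⟩ _ ⟨z, hz, rfl⟩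
    rw [hinj.leftInvOn_invFunOn hy, hinj.leftInvOn_invFunOn hz, Real.dist_eq, dist_eq_norm,
      Real.coe_toNNReal L (by positivity)]
    exact hLip y hy z hz
  -- The height is Lipschitz on the projection of `S`, whatever that set is. A Lipschitz extension
  -- replaces the implicit function theorem, since only containment in a graph is needed.
  obtain ⟨γ, hγ, heq⟩ := hLip'.extend_real
  refine ⟨i, γ, _, hγ, ?_⟩
  filter_upwards [mem_nhdsWithin_of_mem_nhds hU, mem_nhdsWithin_of_mem_nhds hev,
    self_mem_nhdsWithin] with y hyU hy hyΓ
  have hyS : y ∈ S := ⟨⟨hyU, hy⟩, hyΓ⟩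
  refine ⟨dropCoord i y, ?_⟩
  have h := heq (mem_image_of_mem _ hyS)
  simp only [hinj.leftInvOn_invFunOn hyS] at h
  simp only [← h, slice_dropCoord]

/-- The trace inequality in `L^1` on a compact `C^1` hypersurface. -/
theorem IsC1Hypersurface.trace_inequality {d : ℕ} (hd : 1 ≤ d) {Γ : Set (E d)}
    (hΓ : IsC1Hypersurface Γ) (hc : IsCompact Γ) :
    ∃ C : ℝ≥0, ∀ φ : E d → ℝ, ContDiff ℝ 1 φ → HasCompactSupport φ →
      ∫⁻ x, ‖φ x‖ₑ ∂surfaceMeasure Γ ≤ C * ∫⁻ x, ‖fderiv ℝ φ x‖ₑ := by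
  obtain ⟨n, rfl⟩ : ∃ n, d = n + 1 := ⟨d - 1, by omega⟩
  refine hc.induction_on (p := fun s => ∃ C : ℝ≥0, ∀ φ : E (n + 1) → ℝ, ContDiff ℝ 1 φ →
    HasCompactSupport φ → ∫⁻ x, ‖φ x‖ₑ ∂surfaceMeasure s ≤ C * ∫⁻ x, ‖fderiv ℝ φ x‖ₑ)
    ⟨0, fun φ _ _ => by simp [surfaceMeasure]⟩ ?_ ?_ ?_
  · rintro s t hst ⟨C, hC⟩
    exact ⟨C, fun φ h1 h2 => (lintegral_mono_set hst).trans (hC φ h1 h2)⟩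
  · rintro s t ⟨C, hC⟩ ⟨C', hC'⟩
    refine ⟨C + C', fun φ h1 h2 => (lintegral_union_le _ _ _).trans ?_⟩
    push_cast
    rw [add_mul]
    exact add_le_add (hC φ h1 h2) (hC' φ h1 h2)
  · intro x hx
    obtain ⟨i, γ, L, hγ, hev⟩ := hΓ.exists_graph hx
    obtain ⟨C, hC⟩ := trace_graph i hγ
    exact ⟨_, hev, C, hC⟩

/-! ### Test functions and the weak formulation. -/

theorem IsTestFunction.contDiff_one {d : ℕ} {Ω : Set (E d)} {φ : E d → ℝ}
    (h : IsTestFunction Ω φ) : ContDiff ℝ 1 φ := h.smooth.of_le (by exact_mod_cast le_top)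

theorem norm_gradient_eq {d : ℕ} (φ : E d → ℝ) (x : E d) : ‖∇ φ x‖ = ‖fderiv ℝ φ x‖ := by
  simp [gradient]

theorem continuous_gradient {d : ℕ} {φ : E d → ℝ} (h : ContDiff ℝ 1 φ) : Continuous (∇ φ) :=
  (LinearIsometryEquiv.continuous _).comp (h.continuous_fderiv one_ne_zero)

theorem hasCompactSupport_gradient {d : ℕ} {φ : E d → ℝ} (h : HasCompactSupport φ) :
    HasCompactSupport (∇ φ) :=
  (h.fderiv ℝ).comp_left (g := (InnerProductSpace.toDual ℝ (E d)).symm) (map_zero _)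

theorem tsupport_gradient_subset {d : ℕ} (φ : E d → ℝ) : tsupport (∇ φ) ⊆ tsupport φ := by
  refine (closure_mono fun x hx => ?_).trans (tsupport_fderiv_subset ℝ (f := φ))
  intro h
  exact hx (by rw [gradient, h, map_zero])

/-- The trace inequality, applied to a bump function equal to 1 on Γ, bounds the area of Γ. -/
theorem isFiniteMeasure_surfaceMeasure {d : ℕ} (hd : 1 ≤ d) {Γ : Set (E d)}
    (hΓ : IsC1Hypersurface Γ) (hc : IsCompact Γ) : IsFiniteMeasure (surfaceMeasure Γ) := by
  obtain ⟨C, hC⟩ := hΓ.trace_inequality hd hc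
  obtain ⟨r, hr⟩ := hc.isBounded.subset_closedBall 0
  let φ : ContDiffBump (0 : E d) := ⟨max r 1, max r 1 + 1, by positivity, by linarith⟩
  have hb := hC φ φ.contDiff φ.hasCompactSupport
  have hfin : ∫⁻ x, ‖fderiv ℝ φ x‖ₑ < ⊤ :=
    ((φ.contDiff (n := 1)).continuous_fderiv one_ne_zero).integrable_of_hasCompactSupport
      (φ.hasCompactSupport.fderiv ℝ) |>.hasFiniteIntegral
  refine ⟨?_⟩
  calc surfaceMeasure Γ univ = ∫⁻ x in Γ, 1 ∂(Measure.euclideanHausdorffMeasure (d - 1)) := by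
        simp [surfaceMeasure]
    _ ≤ ∫⁻ x in Γ, ‖φ x‖ₑ ∂(Measure.euclideanHausdorffMeasure (d - 1)) := by
        refine setLIntegral_mono φ.continuous.enorm.measurable fun x hx => ?_
        rw [φ.one_of_mem_closedBall (closedBall_subset_closedBall (le_max_left _ _) (hr hx))]
        simp
    _ ≤ _ := hb
    _ < ⊤ := ENNReal.mul_lt_top ENNReal.coe_lt_top hfin

theorem hasWeakGradient_of_test {d : ℕ} {Ω : Set (E d)} {φ : E d → ℝ}
    (hφ : IsTestFunction Ω φ) : HasWeakGradient Ω φ (∇ φ) := by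
  intro ψ hψ
  have hφ1 := hφ.contDiff_one
  have hψ1 := hψ.contDiff_one
  have hz : ∀ {χ : E d → ℝ}, IsTestFunction Ω χ → ∀ x ∉ Ω, χ x = 0 := fun hχ x hx =>
    image_eq_zero_of_notMem_tsupport fun h => hx (hχ.subset h)
  have hi1 : Integrable (fun x => φ x • ∇ ψ x) :=
    (hφ1.continuous.smul (continuous_gradient hψ1)).integrable_of_hasCompactSupport
      hφ.compact.smul_right
  have hi2 : Integrable (fun x => ψ x • ∇ φ x) :=
    (hψ1.continuous.smul (continuous_gradient hφ1)).integrable_of_hasCompactSupport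
      hψ.compact.smul_right
  rw [setIntegral_eq_integral_of_forall_compl_eq_zero (fun x hx => by simp [hz hφ x hx]),
    setIntegral_eq_integral_of_forall_compl_eq_zero (fun x hx => by simp [hz hψ x hx])]
  -- Pairing with a fixed vector reduces the identity to scalar integration by parts in the
  -- direction `c`.
  refine ext_inner_left ℝ fun c => ?_
  rw [inner_neg_right, ← integral_inner hi1, ← integral_inner hi2]
  have hg : ∀ (χ : E d → ℝ) x, inner ℝ c (∇ χ x) = fderiv ℝ χ x c := fun χ x => by
    rw [real_inner_comm, gradient, InnerProductSpace.toDual_symm_apply]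
  have hi1' := hi1.const_inner (𝕜 := ℝ) c
  have hi2' := hi2.const_inner (𝕜 := ℝ) c
  simp only [inner_smul_right, hg] at hi1' hi2' ⊢
  simp only [mul_comm (ψ _)] at hi2' ⊢
  exact integral_mul_fderiv_eq_neg_fderiv_mul_of_integrable hi2' hi1'
    ((hφ1.continuous.mul hψ1.continuous).integrable_of_hasCompactSupport hφ.compact.mul_right)
    (fun x _ => hφ1.differentiable one_ne_zero x) (fun x _ => hψ1.differentiable one_ne_zero x)

theorem memW01p_of_test {d : ℕ} {Ω : Set (E d)} {p : ℝ} {φ : E d → ℝ}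
    (hφ : IsTestFunction Ω φ) : MemW01p Ω p φ (∇ φ) ∧ TestApprox Ω p φ (∇ φ) fun _ => φ := by
  have h : TestApprox Ω p φ (∇ φ) fun _ => φ := ⟨fun _ => hφ, by simp, by simp⟩
  exact ⟨⟨⟨hφ.contDiff_one.continuous.memLp_of_hasCompactSupport hφ.compact,
    (continuous_gradient hφ.contDiff_one).memLp_of_hasCompactSupport
      (hasCompactSupport_gradient hφ.compact), hasWeakGradient_of_test hφ⟩, _, h⟩, h⟩

/-- The right-hand side of the transmission problem is bounded by the total variation of the
test function. -/
theorem IsWeakSolution.abs_integral_flux_le {d : ℕ} {Ω Γ : Set (E d)} {p : ℝ} {f u : E d → ℝ}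
    {Du : E d → E d} (hu : IsWeakSolution Ω Γ p f u Du) [IsFiniteMeasure (surfaceMeasure Γ)]
    {C M : ℝ≥0} (hC : ∀ φ : E d → ℝ, ContDiff ℝ 1 φ → HasCompactSupport φ →
      ∫⁻ x, ‖φ x‖ₑ ∂surfaceMeasure Γ ≤ C * ∫⁻ x, ‖fderiv ℝ φ x‖ₑ)
    (hf : eLpNorm f ∞ (surfaceMeasure Γ) ≤ M) {φ : E d → ℝ} (hφ : IsTestFunction Ω φ) :
    |∫ x in Ω, inner ℝ (flux (fun t : ℝ => t ^ (p - 1)) (Du x)) (∇ φ x)| ≤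
      M * C * ∫ x in Ω, ‖∇ φ x‖ := by
  have h1 := hφ.contDiff_one
  -- A test function is its own trace, through the constant sequence; traces of general functions
  -- are never needed.
  have htr : IsTrace Ω Γ p φ (∇ φ) φ :=
    ⟨h1.continuous.memLp_of_hasCompactSupport hφ.compact, _, (memW01p_of_test hφ).2, by simp⟩
  rw [hu.2 φ (∇ φ) φ (memW01p_of_test hφ).1 htr]
  have hgz : ∀ x ∉ Ω, ‖∇ φ x‖ = 0 := fun x hx => by
    rw [image_eq_zero_of_notMem_tsupport fun h => hx (hφ.subset (tsupport_gradient_subset φ h)),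
      norm_zero]
  rw [setIntegral_eq_integral_of_forall_compl_eq_zero hgz]
  have hfin : ∫⁻ x, ‖∇ φ x‖ₑ < ⊤ :=
    ((continuous_gradient h1).integrable_of_hasCompactSupport
      (hasCompactSupport_gradient hφ.compact)).hasFiniteIntegral
  have hfM : ∀ᵐ x ∂surfaceMeasure Γ, ‖f x‖ₑ ≤ M := by
    filter_upwards [enorm_ae_le_eLpNormEssSup f (surfaceMeasure Γ)] with x hx
    rw [eLpNorm_exponent_top] at hf
    exact hx.trans hf
  have key : ‖∫ x, f x * φ x ∂surfaceMeasure Γ‖ₑ ≤ M * (C * ∫⁻ x, ‖∇ φ x‖ₑ) := by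
    refine (enorm_integral_le_lintegral_enorm _).trans ?_
    calc ∫⁻ x, ‖f x * φ x‖ₑ ∂surfaceMeasure Γ ≤ ∫⁻ x, M * ‖φ x‖ₑ ∂surfaceMeasure Γ := by
          refine lintegral_mono_ae ?_
          filter_upwards [hfM] with x hx
          rw [enorm_mul]
          gcongr
      _ = M * ∫⁻ x, ‖φ x‖ₑ ∂surfaceMeasure Γ :=
          lintegral_const_mul _ h1.continuous.enorm.measurable
      _ ≤ _ := by
          have hn : ∀ x, ‖∇ φ x‖ₑ = ‖fderiv ℝ φ x‖ₑ := fun x => by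
            rw [← ofReal_norm, norm_gradient_eq, ofReal_norm]
          simp only [hn]
          gcongr
          exact hC φ h1 hφ.compact
  rw [integral_norm_eq_lintegral_enorm (continuous_gradient h1).aestronglyMeasurable,
    ← Real.norm_eq_abs, ← toReal_enorm]
  refine (ENNReal.toReal_mono ?_ key).trans (le_of_eq ?_)
  · exact ENNReal.mul_ne_top ENNReal.coe_ne_top (ENNReal.mul_ne_top ENNReal.coe_ne_top hfin.ne)
  · simp [mul_assoc]

/-! ### Approximation by test functions and truncation in W_0^{1,p}. -/

/-- Dominated convergence in `L^q`, for sequences tending to zero. -/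
theorem tendsto_eLpNorm_zero_of_dominated {α F G : Type*} [MeasurableSpace α] {μ : Measure α}
    [NormedAddCommGroup F] [NormedAddCommGroup G] {q : ℝ≥0∞} (hq0 : q ≠ 0) (hq : q ≠ ⊤)
    {f : ℕ → α → F} {g : α → G} (hf : ∀ n, AEStronglyMeasurable (f n) μ) (hg : MemLp g q μ)
    (hb : ∀ n, ∀ᵐ x ∂μ, ‖f n x‖ ≤ ‖g x‖)
    (ht : ∀ᵐ x ∂μ, Tendsto (fun n => f n x) atTop (𝓝 0)) :
    Tendsto (fun n => eLpNorm (f n) q μ) atTop (𝓝 0) := by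
  have hqp : 0 < q.toReal := ENNReal.toReal_pos hq0 hq
  have h := tendsto_lintegral_of_dominated_convergence' (μ := μ)
    (F := fun n x => ‖f n x‖ₑ ^ q.toReal) (f := fun _ => 0) (fun x => ‖g x‖ₑ ^ q.toReal)
    (fun n => (hf n).enorm.pow_const _) (fun n => ?_)
    (lintegral_rpow_enorm_lt_top_of_eLpNorm_lt_top hq0 hq hg.2).ne ?_
  · simp only [eLpNorm_eq_lintegral_rpow_enorm_toReal hq0 hq]
    have h2 := h.ennrpow_const (1 / q.toReal)
    rwa [lintegral_zero, ENNReal.zero_rpow_of_pos (by positivity)] at h2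
  · filter_upwards [hb n] with x hx
    gcongr
    exact enorm_le_iff_norm_le.2 hx
  · filter_upwards [ht] with x hx
    have h2 := (hx.enorm).ennrpow_const q.toReal
    rwa [enorm_zero, ENNReal.zero_rpow_of_pos hqp] at h2

theorem eLpNorm_le_add_of_norm_le {α F G H : Type*} [MeasurableSpace α] {μ : Measure α}
    [NormedAddCommGroup F] [NormedAddCommGroup G] [NormedAddCommGroup H] {q : ℝ≥0∞} (hq : 1 ≤ q)
    {f : α → F} {g : α → G} {h : α → H} (hg : AEStronglyMeasurable g μ)
    (hh : AEStronglyMeasurable h μ) (hb : ∀ᵐ x ∂μ, ‖f x‖ ≤ ‖g x‖ + ‖h x‖) :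
    eLpNorm f q μ ≤ eLpNorm g q μ + eLpNorm h q μ := by
  calc eLpNorm f q μ ≤ eLpNorm (fun x => ‖g x‖ + ‖h x‖) q μ := by
        refine eLpNorm_mono_ae ?_
        filter_upwards [hb] with x hx
        rwa [Real.norm_of_nonneg (by positivity)]
    _ ≤ eLpNorm (fun x => ‖g x‖) q μ + eLpNorm (fun x => ‖h x‖) q μ :=
        eLpNorm_add_le hg.norm hh.norm hq
    _ = _ := by rw [eLpNorm_norm, eLpNorm_norm]

/-- Limits of functions approximable by test functions are approximable. -/
theorem exists_testApprox_of_tendsto {d : ℕ} {Ω : Set (E d)} {p : ℝ} (hp : 1 ≤ p)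
    {w : ℕ → E d → ℝ} {Dw : ℕ → E d → E d} {W : E d → ℝ} {DW : E d → E d}
    (h : ∀ n, ∃ φ, TestApprox Ω p (w n) (Dw n) φ)
    (hw : ∀ n, AEStronglyMeasurable (w n) (volume.restrict Ω))
    (hDw : ∀ n, AEStronglyMeasurable (Dw n) (volume.restrict Ω))
    (hW : AEStronglyMeasurable W (volume.restrict Ω))
    (hDW : AEStronglyMeasurable DW (volume.restrict Ω))
    (ht : Tendsto (fun n => eLpNorm (fun x => W x - w n x) (ENNReal.ofReal p)
      (volume.restrict Ω)) atTop (𝓝 0))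
    (htD : Tendsto (fun n => eLpNorm (fun x => DW x - Dw n x) (ENNReal.ofReal p)
      (volume.restrict Ω)) atTop (𝓝 0)) :
    ∃ φ, TestApprox Ω p W DW φ := by
  have hq : 1 ≤ ENNReal.ofReal p := by simpa using hp
  -- Diagonal choice: one test function within 1/(n+1) of the n-th approximant, in both norms.
  have key : ∀ n : ℕ, ∃ φ, IsTestFunction Ω φ ∧
      eLpNorm (fun x => w n x - φ x) (ENNReal.ofReal p) (volume.restrict Ω) < (n + 1 : ℝ≥0∞)⁻¹ ∧
      eLpNorm (fun x => Dw n x - ∇ φ x) (ENNReal.ofReal p) (volume.restrict Ω) <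
        (n + 1 : ℝ≥0∞)⁻¹ := fun n => by
    obtain ⟨φ, hφ⟩ := h n
    have hpos : (0 : ℝ≥0∞) < (n + 1 : ℝ≥0∞)⁻¹ := by
      rw [ENNReal.inv_pos]
      exact_mod_cast ENNReal.natCast_ne_top (n + 1)
    obtain ⟨m, h1, h2⟩ := ((hφ.tendsto.eventually_lt_const hpos).and
      (hφ.tendsto_grad.eventually_lt_const hpos)).exists
    exact ⟨φ m, hφ.test m, h1, h2⟩
  choose φ hφ h1 h2 using key
  have hinv : Tendsto (fun n : ℕ => (n + 1 : ℝ≥0∞)⁻¹) atTop (𝓝 0) := by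
    have := (tendsto_add_atTop_iff_nat 1).2 ENNReal.tendsto_inv_nat_nhds_zero
    simpa using this
  refine ⟨φ, hφ, ?_, ?_⟩
  · refine tendsto_of_tendsto_of_tendsto_of_le_of_le tendsto_const_nhds
      (by simpa using ht.add hinv) (fun _ => zero_le) fun n => ?_
    refine (eLpNorm_le_add_of_norm_le hq (hW.sub (hw n))
      ((hw n).sub (hφ n).contDiff_one.continuous.aestronglyMeasurable)
      (.of_forall fun x => ?_)).trans (add_le_add le_rfl (h1 n).le)
    simpa using norm_add_le (W x - w n x) (w n x - φ n x)
  · refine tendsto_of_tendsto_of_tendsto_of_le_of_le tendsto_const_nhds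
      (by simpa using htD.add hinv) (fun _ => zero_le) fun n => ?_
    refine (eLpNorm_le_add_of_norm_le hq (hDW.sub (hDw n))
      ((hDw n).sub (continuous_gradient (hφ n).contDiff_one).aestronglyMeasurable)
      (.of_forall fun x => ?_)).trans (add_le_add le_rfl (h2 n).le)
    simpa using norm_add_le (DW x - Dw n x) (Dw n x - ∇ (φ n) x)

theorem TestApprox.comp {d : ℕ} {Ω : Set (E d)} {p : ℝ} {u : E d → ℝ} {Du : E d → E d}
    {φ : ℕ → E d → ℝ} (h : TestApprox Ω p u Du φ) {ns : ℕ → ℕ} (hns : StrictMono ns) :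
    TestApprox Ω p u Du fun n => φ (ns n) :=
  ⟨fun _ => h.test _, h.tendsto.comp hns.tendsto_atTop, h.tendsto_grad.comp hns.tendsto_atTop⟩

/-- Norm convergence implies convergence in measure, hence almost everywhere along a subsequence.
Pointwise convergence is what passes Ψ'(φ_n) to the limit in the chain rule, and it feeds Fatou's
lemma in `poincare`. -/
theorem TestApprox.exists_ae_tendsto {d : ℕ} {Ω : Set (E d)} {p : ℝ} (hp : 0 < p) {u : E d → ℝ}
    {Du : E d → E d} {φ : ℕ → E d → ℝ} (h : TestApprox Ω p u Du φ)
    (hu : AEStronglyMeasurable u (volume.restrict Ω)) :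
    ∃ φ', TestApprox Ω p u Du φ' ∧
      ∀ᵐ x ∂volume.restrict Ω, Tendsto (fun n => φ' n x) atTop (𝓝 (u x)) := by
  have hm : TendstoInMeasure (volume.restrict Ω) φ atTop u := by
    refine tendstoInMeasure_of_tendsto_eLpNorm (p := ENNReal.ofReal p) (by simpa using hp)
      (fun n => (h.test n).contDiff_one.continuous.aestronglyMeasurable) hu ?_
    have := h.tendsto
    simp only [fun n => eLpNorm_sub_comm (φ n) u (ENNReal.ofReal p) (volume.restrict Ω)]
    exact this
  obtain ⟨ns, hns, hae⟩ := hm.exists_seq_tendsto_ae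
  exact ⟨_, h.comp hns, hae⟩

theorem gradient_mul_comp {d : ℕ} {ζ φ : E d → ℝ} {Ψ : ℝ → ℝ} {x : E d}
    (hζ : DifferentiableAt ℝ ζ x) (hφ : DifferentiableAt ℝ φ x) (hΨ : Differentiable ℝ Ψ) :
    ∇ (fun y => ζ y * Ψ (φ y)) x =
      (ζ x * deriv Ψ (φ x)) • ∇ φ x + Ψ (φ x) • ∇ ζ x := by
  have h := hζ.hasFDerivAt.mul ((hΨ (φ x)).hasDerivAt.comp_hasFDerivAt x hφ.hasFDerivAt)
  have h2 : fderiv ℝ (fun y => ζ y * Ψ (φ y)) x = _ := h.fderiv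
  rw [gradient, h2]
  simp [gradient, smul_smul]

theorem IsTestFunction.mul_comp {d : ℕ} {Ω : Set (E d)} {ζ φ : E d → ℝ} {Ψ : ℝ → ℝ}
    (hζ : IsTestFunction Ω ζ) (hφ : ContDiff ℝ ∞ φ) (hΨ : ContDiff ℝ ∞ Ψ) :
    IsTestFunction Ω fun x => ζ x * Ψ (φ x) :=
  ⟨hζ.smooth.mul (hΨ.comp hφ), hζ.compact.mul_right, (tsupport_mul_subset_left).trans hζ.subset⟩

theorem IsTestFunction.exists_bound {d : ℕ} {Ω : Set (E d)} {ζ : E d → ℝ}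
    (hζ : IsTestFunction Ω ζ) : ∃ B, 0 < B ∧ ∀ x, |ζ x| ≤ B ∧ ‖∇ ζ x‖ ≤ B := by
  obtain ⟨B1, h1⟩ := hζ.compact.exists_bound_of_continuous hζ.contDiff_one.continuous
  obtain ⟨B2, h2⟩ := (hasCompactSupport_gradient hζ.compact).exists_bound_of_continuous
    (continuous_gradient hζ.contDiff_one)
  refine ⟨max (max B1 B2) 1, by positivity, fun x => ⟨(h1 x).trans ?_, (h2 x).trans ?_⟩⟩ <;> simp

/-- Localized composition with a smooth Lipschitz function. -/
theorem exists_testApprox_smooth {d : ℕ} {Ω : Set (E d)} {p : ℝ} (hp : 1 ≤ p) {u : E d → ℝ}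
    {Du : E d → E d} (hu : MemLp u (ENNReal.ofReal p) (volume.restrict Ω))
    (hDu : MemLp Du (ENNReal.ofReal p) (volume.restrict Ω))
    (h : ∃ φ, TestApprox Ω p u Du φ) {ζ : E d → ℝ} (hζ : IsTestFunction Ω ζ) {Ψ : ℝ → ℝ}
    (hΨ : ContDiff ℝ ∞ Ψ) {Λ : ℝ} (hΛ : ∀ t, |deriv Ψ t| ≤ Λ) :
    ∃ φ, TestApprox Ω p (fun x => ζ x * Ψ (u x))
      (fun x => (ζ x * deriv Ψ (u x)) • Du x + Ψ (u x) • ∇ ζ x) φ := by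
  have hq : 1 ≤ ENNReal.ofReal p := by simpa using hp
  have hq0 : ENNReal.ofReal p ≠ 0 := (zero_lt_one.trans_le hq).ne'
  obtain ⟨φ₀, hφ₀⟩ := h
  obtain ⟨φ, hφ, hae⟩ := hφ₀.exists_ae_tendsto (by linarith) hu.1
  obtain ⟨B, hB0, hB⟩ := hζ.exists_bound
  have hΛ0 : 0 ≤ Λ := (abs_nonneg _).trans (hΛ 0)
  have hΨd : Differentiable ℝ Ψ := hΨ.differentiable (by simp)
  have hΨc : Continuous (deriv Ψ) := hΨ.continuous_deriv (by simp)
  have hlip : ∀ s t, |Ψ s - Ψ t| ≤ Λ * |s - t| := fun s t =>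
    Convex.norm_image_sub_le_of_norm_deriv_le (fun x _ => hΨd x) (fun x _ => hΛ x) convex_univ
      (mem_univ t) (mem_univ s)
  have hζc : Continuous ζ := hζ.contDiff_one.continuous
  have hφc : ∀ n, Continuous (φ n) := fun n => (hφ.test n).contDiff_one.continuous
  have hφg : ∀ n, Continuous (∇ (φ n)) := fun n => continuous_gradient (hφ.test n).contDiff_one
  refine ⟨fun n x => ζ x * Ψ (φ n x), fun n => hζ.mul_comp (hφ.test n).smooth hΨ, ?_, ?_⟩
  · have hlim : Tendsto (fun n => ENNReal.ofReal (B * Λ) * eLpNorm (fun x => u x - φ n x)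
        (ENNReal.ofReal p) (volume.restrict Ω)) atTop (𝓝 0) := by
      simpa using ENNReal.Tendsto.const_mul hφ.tendsto (Or.inr ENNReal.ofReal_ne_top)
    refine tendsto_of_tendsto_of_tendsto_of_le_of_le tendsto_const_nhds hlim
      (fun _ => zero_le) fun n => ?_
    refine eLpNorm_le_mul_eLpNorm_of_ae_le_mul (.of_forall fun x => ?_) _
    rw [← mul_sub, norm_mul, mul_assoc]
    exact mul_le_mul (hB x).1 (hlip _ _) (norm_nonneg _) hB0.le
  -- The gradient difference splits as ζΨ'(φ_n)(Du - ∇φ_n) + (Ψ(u) - Ψ(φ_n))∇ζ + ζ(Ψ'(u) -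
  -- Ψ'(φ_n))Du. The first two parts are controlled in norm; the third needs almost everywhere
  -- convergence and dominated convergence.
  · have ha : Tendsto (fun n => ENNReal.ofReal (B * Λ) * eLpNorm (fun x => Du x - ∇ (φ n) x)
        (ENNReal.ofReal p) (volume.restrict Ω)) atTop (𝓝 0) := by
      simpa using ENNReal.Tendsto.const_mul hφ.tendsto_grad (Or.inr ENNReal.ofReal_ne_top)
    have hb : Tendsto (fun n => ENNReal.ofReal (B * Λ) * eLpNorm (fun x => u x - φ n x)
        (ENNReal.ofReal p) (volume.restrict Ω)) atTop (𝓝 0) := by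
      simpa using ENNReal.Tendsto.const_mul hφ.tendsto (Or.inr ENNReal.ofReal_ne_top)
    have hm3 : ∀ n, AEStronglyMeasurable
        (fun x => (ζ x * (deriv Ψ (u x) - deriv Ψ (φ n x))) • Du x) (volume.restrict Ω) :=
      fun n => (hζc.aestronglyMeasurable.mul ((hΨc.comp_aestronglyMeasurable hu.1).sub
        (hΨc.comp (hφc n)).aestronglyMeasurable)).smul hDu.1
    have hc : Tendsto (fun n => eLpNorm (fun x => (ζ x * (deriv Ψ (u x) - deriv Ψ (φ n x))) • Du x)
        (ENNReal.ofReal p) (volume.restrict Ω)) atTop (𝓝 0) := by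
      refine tendsto_eLpNorm_zero_of_dominated hq0 ENNReal.ofReal_ne_top hm3
        (hDu.const_smul (B * (2 * Λ))) (fun n => .of_forall fun x => ?_) ?_
      · rw [Pi.smul_apply, norm_smul, norm_smul, Real.norm_of_nonneg (r := B * (2 * Λ)) (by positivity)]
        gcongr
        rw [norm_mul]
        refine mul_le_mul (hB x).1 ((norm_sub_le _ _).trans ?_) (norm_nonneg _) hB0.le
        have h1 := hΛ (u x)
        have h2 := hΛ (φ n x)
        rw [Real.norm_eq_abs, Real.norm_eq_abs]
        linarith
      · filter_upwards [hae] with x hx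
        have h1 := ((hΨc.tendsto (u x)).comp hx).const_sub (deriv Ψ (u x))
        have h2 := (h1.const_mul (ζ x)).smul_const (Du x)
        simpa using h2
    refine tendsto_of_tendsto_of_tendsto_of_le_of_le tendsto_const_nhds
      (by simpa using (ha.add hb).add hc) (fun _ => zero_le) fun n => ?_
    have hm1 : AEStronglyMeasurable (fun x => (ζ x * deriv Ψ (φ n x)) • (Du x - ∇ (φ n) x))
        (volume.restrict Ω) := (hζc.mul (hΨc.comp (hφc n))).aestronglyMeasurable.smul
          (hDu.1.sub (hφg n).aestronglyMeasurable)
    have hm2 : AEStronglyMeasurable (fun x => (Ψ (u x) - Ψ (φ n x)) • ∇ ζ x)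
        (volume.restrict Ω) := ((hΨd.continuous.comp_aestronglyMeasurable hu.1).sub
          (hΨd.continuous.comp (hφc n)).aestronglyMeasurable).smul
          (continuous_gradient hζ.contDiff_one).aestronglyMeasurable
    have e1 : eLpNorm (fun x => (ζ x * deriv Ψ (φ n x)) • (Du x - ∇ (φ n) x)) (ENNReal.ofReal p)
        (volume.restrict Ω) ≤ ENNReal.ofReal (B * Λ) * eLpNorm (fun x => Du x - ∇ (φ n) x)
        (ENNReal.ofReal p) (volume.restrict Ω) := by
      refine eLpNorm_le_mul_eLpNorm_of_ae_le_mul (.of_forall fun x => ?_) _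
      rw [norm_smul, norm_mul]
      gcongr
      exacts [(hB x).1, hΛ _]
    have e2 : eLpNorm (fun x => (Ψ (u x) - Ψ (φ n x)) • ∇ ζ x) (ENNReal.ofReal p)
        (volume.restrict Ω) ≤ ENNReal.ofReal (B * Λ) * eLpNorm (fun x => u x - φ n x)
        (ENNReal.ofReal p) (volume.restrict Ω) := by
      refine eLpNorm_le_mul_eLpNorm_of_ae_le_mul (.of_forall fun x => ?_) _
      rw [norm_smul, mul_comm, mul_assoc]
      exact mul_le_mul (hB x).2 (hlip _ _) (norm_nonneg _) hB0.le
    refine (eLpNorm_le_add_of_norm_le hq (hm1.add hm2) (hm3 n) (.of_forall fun x => ?_)).trans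
      (add_le_add ((eLpNorm_add_le hm1 hm2 hq).trans (add_le_add e1 e2)) le_rfl)
    refine le_trans (le_of_eq ?_) (norm_add_le _ _)
    rw [gradient_mul_comp (hζ.contDiff_one.differentiable one_ne_zero x)
      ((hφ.test n).contDiff_one.differentiable one_ne_zero x) hΨd]
    simp only [Pi.add_apply]
    congr 1
    module

/-- `ψ` is a pointwise limit of smooth, uniformly Lipschitz functions whose derivatives converge
pointwise to the indicator function `χ`, and `ψ` vanishes where `χ` does. -/
structure IsTruncation (ψ χ : ℝ → ℝ) : Prop where
  approx : ∃ (Λ : ℝ) (Ψ : ℕ → ℝ → ℝ), (∀ n, ContDiff ℝ ∞ (Ψ n)) ∧ (∀ n t, |deriv (Ψ n) t| ≤ Λ) ∧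
    (∀ n t, |Ψ n t| ≤ |t|) ∧ (∀ t, Tendsto (fun n => Ψ n t) atTop (𝓝 (ψ t))) ∧
    (∀ t, Tendsto (fun n => deriv (Ψ n) t) atTop (𝓝 (χ t)))
  zero_or_one : ∀ t, χ t = 0 ∨ χ t = 1
  eq_zero : ∀ t, χ t = 0 → ψ t = 0

theorem isTruncation_id : IsTruncation id fun _ => 1 :=
  ⟨⟨1, fun _ => id, fun _ => contDiff_id, fun n t => by simp, fun n t => le_rfl,
    fun t => tendsto_const_nhds, fun t => by simp⟩, fun _ => Or.inr rfl, by simp⟩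

theorem exists_abs_deriv_smoothTransition_le :
    ∃ S : ℝ, 0 < S ∧ (∀ t, |deriv Real.smoothTransition t| ≤ S) ∧
      (∀ t < 0, deriv Real.smoothTransition t = 0) ∧
      (∀ t > 1, deriv Real.smoothTransition t = 0) := by
  have hc : Continuous (deriv Real.smoothTransition) :=
    (Real.smoothTransition.contDiff (n := 1)).continuous_deriv le_rfl
  obtain ⟨S, hS⟩ := (isCompact_Icc (a := (0 : ℝ)) (b := 1)).exists_bound_of_continuousOn
    hc.continuousOn
  have h0 : ∀ t < 0, deriv Real.smoothTransition t = 0 := fun t ht => by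
    have : Real.smoothTransition =ᶠ[𝓝 t] fun _ => 0 := by
      filter_upwards [Iio_mem_nhds ht] with s hs
      exact Real.smoothTransition.zero_of_nonpos (le_of_lt hs)
    rw [this.deriv_eq, deriv_const]
  have h1 : ∀ t > 1, deriv Real.smoothTransition t = 0 := fun t ht => by
    have : Real.smoothTransition =ᶠ[𝓝 t] fun _ => 1 := by
      filter_upwards [Ioi_mem_nhds ht] with s hs
      exact Real.smoothTransition.one_of_one_le (le_of_lt hs)
    rw [this.deriv_eq, deriv_const]
  refine ⟨max S 1, by positivity, fun t => ?_, h0, h1⟩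
  rcases lt_or_ge t 0 with h | h
  · simp [h0 t h]
  rcases lt_or_ge 1 t with h' | h'
  · simp [h1 t h']
  · exact (hS t ⟨h, h'⟩).trans (le_max_left _ _)

/-- With σ the smooth step, the approximants are (t - k)σ(n(t - k)), whose derivative is σ(s) +
sσ'(s) at s = n(t - k). As σ' is supported in [0,1], the second term is bounded uniformly in n and
vanishes for s ≤ 0 and for s > 1, which covers every t ≤ k and, for large n, every t > k. The sign
of `k` gives the domination by |t|. -/
theorem isTruncation_posPart {k : ℝ} (hk : 0 ≤ k) :
    IsTruncation (fun t => max (t - k) 0) fun t => if k < t then 1 else 0 := by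
  obtain ⟨S, hS0, hS, hneg, hlarge⟩ := exists_abs_deriv_smoothTransition_le
  have hderiv : ∀ (n : ℕ) t, HasDerivAt (fun t : ℝ => (t - k) * Real.smoothTransition (n * (t - k)))
      (Real.smoothTransition (n * (t - k)) + (n * (t - k)) *
        deriv Real.smoothTransition (n * (t - k))) t := fun n t => by
    have h1 : HasDerivAt (fun t : ℝ => t - k) 1 t := (hasDerivAt_id t).sub_const k
    have h2 := ((Real.smoothTransition.contDiff (n := 1)).differentiable one_ne_zero
      (n * (t - k))).hasDerivAt.comp t (h1.const_mul (n : ℝ))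
    refine (h1.mul h2).congr_deriv ?_
    simp only [Function.comp_apply]
    ring
  have hle : ∀ t ≤ k, ∀ n : ℕ, (n : ℝ) * (t - k) ≤ 0 := fun t ht n =>
    mul_nonpos_of_nonneg_of_nonpos n.cast_nonneg (by linarith)
  have h00 : deriv Real.smoothTransition 0 = 0 := by
    have hc : Continuous (deriv Real.smoothTransition) :=
      (Real.smoothTransition.contDiff (n := 1)).continuous_deriv le_rfl
    have hl : Tendsto (deriv Real.smoothTransition) (𝓝[<] (0 : ℝ))
      (𝓝 (deriv Real.smoothTransition 0)) := (hc.tendsto 0).mono_left nhdsWithin_le_nhds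
    refine tendsto_nhds_unique hl (tendsto_const_nhds.congr' ?_)
    filter_upwards [self_mem_nhdsWithin] with t ht using (hneg t ht).symm
  have hnonpos : ∀ t ≤ 0, deriv Real.smoothTransition t = 0 := fun t ht => by
    rcases ht.lt_or_eq with h | rfl
    exacts [hneg t h, h00]
  have hev : ∀ t, k < t → ∀ᶠ n : ℕ in atTop, 1 < (n : ℝ) * (t - k) := fun t ht => by
    exact (tendsto_natCast_atTop_atTop.atTop_mul_const (sub_pos.2 ht)).eventually_gt_atTop 1
  refine ⟨⟨1 + S, fun n t => (t - k) * Real.smoothTransition (n * (t - k)), fun n => ?_,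
    fun n t => ?_, fun n t => ?_, fun t => ?_, fun t => ?_⟩, fun t => ?_, fun t h => ?_⟩
  · exact (contDiff_id.sub contDiff_const).mul
      (Real.smoothTransition.contDiff.comp (contDiff_const.mul (contDiff_id.sub contDiff_const)))
  · rw [(hderiv n t).deriv]
    refine (abs_add_le _ _).trans (add_le_add ?_ ?_)
    · rw [abs_of_nonneg (Real.smoothTransition.nonneg _)]
      exact Real.smoothTransition.le_one _
    · rw [abs_mul]
      rcases le_or_gt ((n : ℝ) * (t - k)) 0 with h | h
      · simp [hnonpos _ h, hS0.le]
      rcases le_or_gt ((n : ℝ) * (t - k)) 1 with h' | h'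
      · rw [abs_of_pos h]
        nlinarith [hS (n * (t - k)), abs_nonneg (deriv Real.smoothTransition (n * (t - k)))]
      · simp [hlarge _ h', hS0.le]
  · rcases le_or_gt t k with h | h
    · simp [Real.smoothTransition.zero_of_nonpos (hle t h n)]
    · rw [abs_mul, abs_of_nonneg (Real.smoothTransition.nonneg _), abs_of_pos (sub_pos.2 h),
        abs_of_pos (hk.trans_lt h)]
      nlinarith [Real.smoothTransition.le_one (n * (t - k)),
        Real.smoothTransition.nonneg (n * (t - k))]
  · rcases le_or_gt t k with h | h
    · simp [Real.smoothTransition.zero_of_nonpos (hle t h _), h]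
    · refine tendsto_const_nhds.congr' ?_
      filter_upwards [hev t h] with n hn
      rw [Real.smoothTransition.one_of_one_le hn.le, mul_one, max_eq_left (by linarith)]
  · simp only [(hderiv _ t).deriv]
    rcases le_or_gt t k with h | h
    · simp [Real.smoothTransition.zero_of_nonpos (hle t h _), hnonpos _ (hle t h _), h.not_gt]
    · refine tendsto_const_nhds.congr' ?_
      filter_upwards [hev t h] with n hn
      rw [Real.smoothTransition.one_of_one_le hn.le, hlarge _ hn]
      simp [h]
  · split_ifs <;> simp
  · have : ¬ k < t := by
      by_contra h'
      simp [h'] at h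
    exact max_eq_right (by linarith)

namespace IsTruncation

variable {ψ χ : ℝ → ℝ}

theorem measurable (h : IsTruncation ψ χ) : Measurable ψ ∧ Measurable χ := by
  obtain ⟨Λ, Ψ, hΨ, -, -, h1, h2⟩ := h.approx
  exact ⟨measurable_of_tendsto_metrizable (fun n => (hΨ n).continuous.measurable)
    (tendsto_pi_nhds.2 h1), measurable_of_tendsto_metrizable
    (fun n => ((hΨ n).continuous_deriv (by simp)).measurable) (tendsto_pi_nhds.2 h2)⟩

theorem abs_le (h : IsTruncation ψ χ) (t : ℝ) : |ψ t| ≤ |t| := by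
  obtain ⟨Λ, Ψ, -, -, hb, h1, -⟩ := h.approx
  exact le_of_tendsto (h1 t).abs (.of_forall fun n => hb n t)

theorem nonneg (h : IsTruncation ψ χ) (t : ℝ) : 0 ≤ χ t := by
  rcases h.zero_or_one t with h | h <;> simp [h]

theorem le_one (h : IsTruncation ψ χ) (t : ℝ) : χ t ≤ 1 := by
  rcases h.zero_or_one t with h | h <;> simp [h]

/-- Localized composition with a truncation. -/
theorem exists_testApprox (hψ : IsTruncation ψ χ) {d : ℕ} {Ω : Set (E d)} {p : ℝ} (hp : 1 ≤ p)
    {u : E d → ℝ} {Du : E d → E d} (hu : MemLp u (ENNReal.ofReal p) (volume.restrict Ω))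
    (hDu : MemLp Du (ENNReal.ofReal p) (volume.restrict Ω))
    (h : ∃ φ, TestApprox Ω p u Du φ) {ζ : E d → ℝ} (hζ : IsTestFunction Ω ζ) :
    ∃ φ, TestApprox Ω p (fun x => ζ x * ψ (u x))
      (fun x => (ζ x * χ (u x)) • Du x + ψ (u x) • ∇ ζ x) φ := by
  have hq : 1 ≤ ENNReal.ofReal p := by simpa using hp
  have hq0 : ENNReal.ofReal p ≠ 0 := (zero_lt_one.trans_le hq).ne'
  obtain ⟨B, hB0, hB⟩ := hζ.exists_bound
  obtain ⟨hmψ, hmχ⟩ := hψ.measurable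
  have habs := hψ.abs_le
  have hχ0 := hψ.nonneg
  have hχ1 := hψ.le_one
  obtain ⟨Λ, Ψ, hΨ, hΛ, hΨb, h1, h2⟩ := hψ.approx
  have hΛ0 : 0 ≤ Λ := (abs_nonneg _).trans (hΛ 0 0)
  have hΨd : ∀ n, Differentiable ℝ (Ψ n) := fun n => (hΨ n).differentiable (by simp)
  have hΨc : ∀ n, Continuous (deriv (Ψ n)) := fun n => (hΨ n).continuous_deriv (by simp)
  have hζm : AEStronglyMeasurable ζ (volume.restrict Ω) :=
    hζ.contDiff_one.continuous.aestronglyMeasurable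
  have hζg : AEStronglyMeasurable (∇ ζ) (volume.restrict Ω) :=
    (continuous_gradient hζ.contDiff_one).aestronglyMeasurable
  have m1 : AEStronglyMeasurable (fun x => ψ (u x)) (volume.restrict Ω) :=
    (hmψ.comp_aemeasurable hu.1.aemeasurable).aestronglyMeasurable
  have m2 : AEStronglyMeasurable (fun x => χ (u x)) (volume.restrict Ω) :=
    (hmχ.comp_aemeasurable hu.1.aemeasurable).aestronglyMeasurable
  have m3 : ∀ n, AEStronglyMeasurable (fun x => Ψ n (u x)) (volume.restrict Ω) := fun n =>
    (hΨd n).continuous.comp_aestronglyMeasurable hu.1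
  have m4 : ∀ n, AEStronglyMeasurable (fun x => deriv (Ψ n) (u x)) (volume.restrict Ω) := fun n =>
    (hΨc n).comp_aestronglyMeasurable hu.1
  have hdiff : ∀ n t, ‖ψ t - Ψ n t‖ ≤ 2 * ‖t‖ := fun n t => by
    refine (norm_sub_le _ _).trans ?_
    have := habs t
    have := hΨb n t
    simp only [Real.norm_eq_abs]
    linarith
  refine exists_testApprox_of_tendsto hp
    (fun n => exists_testApprox_smooth hp hu hDu h hζ (hΨ n) (hΛ n))
    (fun n => hζm.mul (m3 n)) (fun n => ((hζm.mul (m4 n)).smul hDu.1).add ((m3 n).smul hζg))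
    (hζm.mul m1) (((hζm.mul m2).smul hDu.1).add (m1.smul hζg)) ?_ ?_
  · refine tendsto_eLpNorm_zero_of_dominated hq0 ENNReal.ofReal_ne_top
      (fun n => (hζm.mul m1).sub (hζm.mul (m3 n))) (hu.const_smul (B * 2))
      (fun n => .of_forall fun x => ?_) (.of_forall fun x => ?_)
    · rw [← mul_sub, norm_mul, Pi.smul_apply, norm_smul,
        Real.norm_of_nonneg (r := B * 2) (by positivity), mul_assoc]
      exact mul_le_mul (hB x).1 (hdiff n _) (norm_nonneg _) hB0.le
    · simpa using ((h1 (u x)).const_mul (ζ x)).const_sub (ζ x * ψ (u x))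
  · have hbd : MemLp (fun x => (B * (1 + Λ)) * ‖Du x‖ + (B * 2) * ‖u x‖) (ENNReal.ofReal p)
        (volume.restrict Ω) := (hDu.norm.const_mul _).add (hu.norm.const_mul _)
    refine tendsto_eLpNorm_zero_of_dominated hq0 ENNReal.ofReal_ne_top
      (fun n => (((hζm.mul m2).smul hDu.1).add (m1.smul hζg)).sub
        (((hζm.mul (m4 n)).smul hDu.1).add ((m3 n).smul hζg))) hbd
      (fun n => .of_forall fun x => ?_) (.of_forall fun x => ?_)
    · have e : (ζ x * χ (u x)) • Du x + ψ (u x) • ∇ ζ x -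
          ((ζ x * deriv (Ψ n) (u x)) • Du x + Ψ n (u x) • ∇ ζ x) =
          (ζ x * (χ (u x) - deriv (Ψ n) (u x))) • Du x + (ψ (u x) - Ψ n (u x)) • ∇ ζ x := by
        module
      rw [e, Real.norm_of_nonneg (by positivity)]
      refine (norm_add_le _ _).trans (add_le_add ?_ ?_)
      · rw [norm_smul, norm_mul]
        have hd : ‖χ (u x) - deriv (Ψ n) (u x)‖ ≤ 1 + Λ := by
          refine (norm_sub_le _ _).trans (add_le_add ?_ (hΛ n _))
          rw [Real.norm_of_nonneg (hχ0 _)]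
          exact hχ1 _
        gcongr
        exact (hB x).1
      · rw [norm_smul, mul_comm, mul_assoc]
        exact mul_le_mul (hB x).2 (hdiff n _) (norm_nonneg _) hB0.le
    · have t1 := ((h2 (u x)).const_mul (ζ x)).smul_const (Du x)
      have t2 := (h1 (u x)).smul_const (∇ ζ x)
      simpa using (t1.add t2).const_sub ((ζ x * χ (u x)) • Du x + ψ (u x) • ∇ ζ x)

end IsTruncation

/-! ### The bounded-flux condition and the Caccioppoli inequality. -/

theorem inner_flux_self {d : ℕ} {p : ℝ} (hp : 0 < p) (ξ : E d) :
    inner ℝ (flux (fun t : ℝ => t ^ (p - 1)) ξ) ξ = ‖ξ‖ ^ p := by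
  rcases eq_or_ne ξ 0 with rfl | h
  · simp [Real.zero_rpow hp.ne']
  · have hn : 0 < ‖ξ‖ := norm_pos_iff.2 h
    rw [flux, real_inner_smul_left, real_inner_self_eq_norm_sq, Real.rpow_sub_one hn.ne']
    field_simp

theorem norm_flux_le {d : ℕ} (p : ℝ) (ξ : E d) :
    ‖flux (fun t : ℝ => t ^ (p - 1)) ξ‖ ≤ ‖ξ‖ ^ (p - 1) := by
  rcases eq_or_ne ξ 0 with rfl | h
  · simp only [flux, smul_zero, norm_zero]
    exact Real.rpow_nonneg le_rfl _
  · have hn : 0 < ‖ξ‖ := norm_pos_iff.2 h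
    rw [flux, norm_smul, Real.norm_of_nonneg (by positivity)]
    exact (div_mul_cancel₀ _ hn.ne').le

theorem aestronglyMeasurable_flux {d : ℕ} {p : ℝ} {μ : Measure (E d)} {Du : E d → E d}
    (h : AEStronglyMeasurable Du μ) :
    AEStronglyMeasurable (fun x => flux (fun t : ℝ => t ^ (p - 1)) (Du x)) μ := by
  have hm : Measurable (flux (d := d) fun t : ℝ => t ^ (p - 1)) := by
    unfold flux
    fun_prop
  exact (hm.comp_aemeasurable h.aemeasurable).aestronglyMeasurable

/-- `u` belongs to `W_0^{1,p}(Ω)` with gradient `Du`, and `-div (|Du|^{p-2} Du)` is bounded by `K`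
in the dual of the space of functions of bounded variation. -/
structure FluxBounded {d : ℕ} (Ω : Set (E d)) (p K : ℝ) (u : E d → ℝ) (Du : E d → E d) :
    Prop where
  memLp : MemLp u (ENNReal.ofReal p) (volume.restrict Ω)
  memLp_grad : MemLp Du (ENNReal.ofReal p) (volume.restrict Ω)
  approx : ∃ φ, TestApprox Ω p u Du φ
  bound : ∀ φ, IsTestFunction Ω φ →
    |∫ x in Ω, inner ℝ (flux (fun t : ℝ => t ^ (p - 1)) (Du x)) (∇ φ x)| ≤
      K * ∫ x in Ω, ‖∇ φ x‖

theorem gradient_neg_apply {d : ℕ} (φ : E d → ℝ) (x : E d) :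
    ∇ (fun y => -φ y) x = -∇ φ x := by
  have h : fderiv ℝ (fun y => -φ y) x = -fderiv ℝ φ x := fderiv_fun_neg
  rw [gradient, h, map_neg, gradient]

/-- The flux is odd, so the class is symmetric. This turns one-sided bounds from level sets above k
into two-sided ones. -/
theorem FluxBounded.neg {d : ℕ} {Ω : Set (E d)} {p K : ℝ} {u : E d → ℝ} {Du : E d → E d}
    (h : FluxBounded Ω p K u Du) : FluxBounded Ω p K (fun x => -u x) (fun x => -Du x) := by
  obtain ⟨φ, hφ⟩ := h.approx
  refine ⟨h.memLp.neg, h.memLp_grad.neg, ⟨fun n x => -φ n x, fun n => ⟨(hφ.test n).smooth.neg,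
    (hφ.test n).compact.neg, ?_⟩, ?_, ?_⟩, fun φ hφ => ?_⟩
  · have : tsupport (fun x => -φ n x) = tsupport (φ n) := by
      simp [tsupport, Function.support_fun_neg]
    exact this ▸ (hφ.test n).subset
  · refine hφ.tendsto.congr fun n => ?_
    rw [← eLpNorm_neg]
    congr 1
    ext x
    simp only [Pi.neg_apply]
    ring
  · refine hφ.tendsto_grad.congr fun n => ?_
    rw [← eLpNorm_neg]
    congr 1
    ext x
    simp only [Pi.neg_apply, gradient_neg_apply, neg_sub, sub_neg_eq_add]
    rw [neg_add_eq_sub]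
  · have := h.bound φ hφ
    simpa [flux, integral_neg] using this

/-- Hölder's inequality with exponents `p` and `p / (p - 1)`. -/
theorem lintegral_enorm_mul_rpow_le {α F G : Type*} [MeasurableSpace α] {μ : Measure α}
    [NormedAddCommGroup F] [NormedAddCommGroup G] {p : ℝ} (hp : 1 < p) {f : α → F} {g : α → G}
    (hf : AEStronglyMeasurable f μ) (hg : AEStronglyMeasurable g μ) :
    ∫⁻ x, ‖f x‖ₑ * ‖g x‖ₑ ^ (p - 1) ∂μ ≤
      eLpNorm f (ENNReal.ofReal p) μ * eLpNorm g (ENNReal.ofReal p) μ ^ (p - 1) := by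
  have hp0 : 0 < p := by linarith
  have h := ENNReal.lintegral_mul_rpow_le_lintegral_rpow_mul_lintegral_rpow
    (Real.HolderConjugate.conjExponent hp) hf.enorm hg.enorm
  refine h.trans (le_of_eq ?_)
  rw [eLpNorm_eq_lintegral_rpow_enorm_toReal (by simpa using hp0) ENNReal.ofReal_ne_top,
    eLpNorm_eq_lintegral_rpow_enorm_toReal (by simpa using hp0) ENNReal.ofReal_ne_top,
    ENNReal.toReal_ofReal hp0.le, ← ENNReal.rpow_mul]
  congr 2
  rw [Real.conjExponent]
  have : p - 1 ≠ 0 := by linarith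
  field_simp

theorem enorm_inner_flux_le {d : ℕ} {p : ℝ} (hp : 1 < p) (ξ η : E d) :
    ‖(inner ℝ (flux (fun t : ℝ => t ^ (p - 1)) ξ) η : ℝ)‖ₑ ≤ ‖η‖ₑ * ‖ξ‖ₑ ^ (p - 1) := by
  rw [← ofReal_norm η, ← ofReal_norm ξ, ENNReal.ofReal_rpow_of_nonneg (norm_nonneg _)
    (by linarith), ← ENNReal.ofReal_mul (norm_nonneg _), ← ofReal_norm]
  refine ENNReal.ofReal_le_ofReal ((norm_inner_le_norm _ _).trans ?_)
  rw [mul_comm]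
  exact mul_le_mul_of_nonneg_left (norm_flux_le p ξ) (norm_nonneg _)

theorem integrable_inner_flux {d : ℕ} {μ : Measure (E d)} {p : ℝ} (hp : 1 < p) {Du X : E d → E d}
    (hDu : MemLp Du (ENNReal.ofReal p) μ) (hX : MemLp X (ENNReal.ofReal p) μ) :
    Integrable (fun x => (inner ℝ (flux (fun t : ℝ => t ^ (p - 1)) (Du x)) (X x) : ℝ)) μ := by
  refine ⟨(aestronglyMeasurable_flux hDu.1).inner hX.1, ?_⟩
  refine (lintegral_mono fun x => enorm_inner_flux_le hp (Du x) (X x)).trans_lt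
    ((lintegral_enorm_mul_rpow_le hp hX.1 hDu.1).trans_lt ?_)
  exact ENNReal.mul_lt_top hX.2 (ENNReal.rpow_lt_top_of_nonneg (by linarith) hDu.2.ne)

/-- Both sides are continuous under gradient convergence in L^p: the left by Hölder's inequality,
the right because L^p convergence implies L^1 convergence on a set of finite measure. -/
theorem FluxBounded.bound_of_approx {d : ℕ} {Ω : Set (E d)} [IsFiniteMeasure (volume.restrict Ω)]
    {p K : ℝ} (hp : 1 < p) {u w : E d → ℝ} {Du Dw : E d → E d} (h : FluxBounded Ω p K u Du)
    (hDw : MemLp Dw (ENNReal.ofReal p) (volume.restrict Ω)) (hw : ∃ φ, TestApprox Ω p w Dw φ) :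
    ∫ x in Ω, inner ℝ (flux (fun t : ℝ => t ^ (p - 1)) (Du x)) (Dw x) ≤
      K * ∫ x in Ω, ‖Dw x‖ := by
  obtain ⟨φ, hφ⟩ := hw
  have hq : 1 ≤ ENNReal.ofReal p := by simpa using hp.le
  have hm : ∀ n, MemLp (∇ (φ n)) (ENNReal.ofReal p) (volume.restrict Ω) := fun n =>
    (memW01p_of_test (hφ.test n)).1.1.memLp_grad
  have t1 : Tendsto (fun n => ∫ x in Ω,
      (inner ℝ (flux (fun t : ℝ => t ^ (p - 1)) (Du x)) (∇ (φ n) x) : ℝ)) atTop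
      (𝓝 (∫ x in Ω, (inner ℝ (flux (fun t : ℝ => t ^ (p - 1)) (Du x)) (Dw x) : ℝ))) := by
    refine tendsto_integral_of_L1 _ (integrable_inner_flux hp h.memLp_grad hDw).1
      (.of_forall fun n => integrable_inner_flux hp h.memLp_grad (hm n)) ?_
    have hlim : Tendsto (fun n => eLpNorm (fun x => Dw x - ∇ (φ n) x) (ENNReal.ofReal p)
        (volume.restrict Ω) * eLpNorm Du (ENNReal.ofReal p) (volume.restrict Ω) ^ (p - 1))
        atTop (𝓝 0) := by
      simpa using ENNReal.Tendsto.mul_const hφ.tendsto_grad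
        (Or.inr (ENNReal.rpow_lt_top_of_nonneg (by linarith) h.memLp_grad.2.ne).ne)
    refine tendsto_of_tendsto_of_tendsto_of_le_of_le tendsto_const_nhds hlim
      (fun _ => zero_le) fun n => ?_
    refine le_trans (lintegral_mono fun x => ?_)
      (lintegral_enorm_mul_rpow_le hp (hDw.sub (hm n)).1 h.memLp_grad.1)
    rw [← inner_sub_right, ← neg_sub (Dw x), inner_neg_right, enorm_neg]
    exact enorm_inner_flux_le hp _ _
  have t2 : Tendsto (fun n => ∫ x in Ω, ‖∇ (φ n) x‖) atTop (𝓝 (∫ x in Ω, ‖Dw x‖)) := by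
    refine tendsto_integral_of_L1 _ (hDw.integrable hq).norm.1
      (.of_forall fun n => ((hm n).integrable hq).norm) ?_
    have hlim : Tendsto (fun n => eLpNorm (fun x => Dw x - ∇ (φ n) x) (ENNReal.ofReal p)
        (volume.restrict Ω) * (volume.restrict Ω) univ ^
          (1 / (1 : ℝ≥0∞).toReal - 1 / (ENNReal.ofReal p).toReal)) atTop (𝓝 0) := by
      have hc : 0 ≤ 1 / (1 : ℝ≥0∞).toReal - 1 / (ENNReal.ofReal p).toReal := by
        rw [ENNReal.toReal_ofReal (by linarith), ENNReal.toReal_one, div_one, sub_nonneg,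
          div_le_one (by linarith)]
        exact hp.le
      simpa using ENNReal.Tendsto.mul_const hφ.tendsto_grad
        (Or.inr (ENNReal.rpow_lt_top_of_nonneg hc
          (measure_ne_top (volume.restrict Ω) univ)).ne)
    refine tendsto_of_tendsto_of_tendsto_of_le_of_le tendsto_const_nhds hlim
      (fun _ => zero_le) fun n => ?_
    refine le_trans ?_ (eLpNorm_le_eLpNorm_mul_rpow_measure_univ hq (hDw.sub (hm n)).1)
    rw [eLpNorm_one_eq_lintegral_enorm]
    refine lintegral_mono fun x => enorm_le_iff_norm_le.2 ?_
    rw [norm_sub_rev (Dw x)]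
    exact abs_norm_sub_norm_le _ _
  exact le_of_tendsto_of_tendsto' t1 (t2.const_mul K)
    fun n => (le_abs_self _).trans (h.bound _ (hφ.test n))

/-- The cut is at t^{p-1} = 4K: above it K t ≤ t^p/4, below it K t is at most its value there, which
is κ. That κ vanishes with K is needed when the datum is zero. -/
theorem exists_young_const {p K : ℝ} (hp : 1 < p) (hK : 0 ≤ K) :
    ∃ κ : ℝ, 0 ≤ κ ∧ (K = 0 → κ = 0) ∧ ∀ t : ℝ, 0 ≤ t → K * t ≤ t ^ p / 4 + κ := by
  have hp1 : 0 < p - 1 := by linarith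
  refine ⟨K * (4 * K) ^ (1 / (p - 1)), by positivity, fun h => by simp [h], fun t ht => ?_⟩
  rcases le_or_gt t ((4 * K) ^ (1 / (p - 1))) with h | h
  · have := mul_le_mul_of_nonneg_left h hK
    have := Real.rpow_nonneg ht p
    linarith
  · have h1 : 4 * K ≤ t ^ (p - 1) := by
      have := Real.rpow_le_rpow (by positivity) h.le hp1.le
      rwa [← Real.rpow_mul (by positivity), one_div_mul_cancel hp1.ne', Real.rpow_one] at this
    have h2 : t ^ p = t ^ (p - 1) * t := by
      rw [← Real.rpow_add_one' ht (by linarith), sub_add_cancel]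
    have h3 : 0 ≤ K * (4 * K) ^ (1 / (p - 1)) := by positivity
    rw [h2]
    nlinarith

/-- Young's inequality with the coefficient 1/4 prescribed, obtained by comparing a with 4b. The
quarter here and the one in `exists_young_const` together use up half of the energy. -/
theorem rpow_sub_one_mul_le {p a b : ℝ} (hp : 1 < p) (ha : 0 ≤ a) (hb : 0 ≤ b) :
    a ^ (p - 1) * b ≤ a ^ p / 4 + 4 ^ (p - 1) * b ^ p := by
  have h2 : ∀ t : ℝ, 0 ≤ t → t ^ p = t ^ (p - 1) * t := fun t ht => by
    rw [← Real.rpow_add_one' ht (by linarith), sub_add_cancel]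
  rcases le_or_gt (4 * b) a with h | h
  · have : a ^ (p - 1) * b ≤ a ^ (p - 1) * (a / 4) := by
      gcongr
      linarith
    have h3 : 0 ≤ 4 ^ (p - 1) * b ^ p := by positivity
    rw [h2 a ha]
    linarith
  · have h3 : a ^ (p - 1) ≤ (4 * b) ^ (p - 1) := Real.rpow_le_rpow ha h.le (by linarith)
    rw [Real.mul_rpow (by norm_num) hb] at h3
    have h4 := mul_le_mul_of_nonneg_right h3 hb
    rw [h2 b hb]
    have : 0 ≤ a ^ p := by positivity
    linarith

/-- `ζ` is a cut-off function supported in `S`, with gradient controlled by a power of `ζ`. -/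
structure IsCutoff {d : ℕ} (S : Set (E d)) (p L : ℝ) (ζ : E d → ℝ) : Prop where
  nonneg : ∀ x, 0 ≤ ζ x
  le_one : ∀ x, ζ x ≤ 1
  grad_le : ∀ x, ‖∇ ζ x‖ ≤ L * ζ x ^ (1 - 1 / p)
  eq_zero : ∀ x ∉ S, ζ x = 0

/-- Here z, a, s stand for ζ, |Du|, |ψ(u)|. The exponent 1 - 1/p on the cut-off is what makes
a^{p-1} z^{1-1/p} equal to (z^{1/p} a)^{p-1}, so Young's inequality produces exactly z a^p. One κ
comes from K z a, the other from K L s, whose quarter of (L s)^p accounts for the added 1 in the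
coefficient. -/
theorem energy_pointwise {p K κ L z a s : ℝ} (hp : 1 < p)
    (hκ : ∀ t : ℝ, 0 ≤ t → K * t ≤ t ^ p / 4 + κ) (hK : 0 ≤ K) (hκ0 : 0 ≤ κ)
    (hL : 0 ≤ L) (hz0 : 0 ≤ z) (hz1 : z ≤ 1) (ha : 0 ≤ a) (hs : 0 ≤ s) :
    z * a ^ p / 2 - (4 ^ (p - 1) + 1) * L ^ p * s ^ p - 2 * κ ≤
      z * a ^ p - a ^ (p - 1) * (s * (L * z ^ (1 - 1 / p))) -
        K * (z * a + s * (L * z ^ (1 - 1 / p))) := by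
  have hp0 : 0 < p := by linarith
  have e1 : z * a ^ p = (z ^ (1 / p) * a) ^ p := by
    rw [Real.mul_rpow (by positivity) ha, ← Real.rpow_mul hz0, one_div_mul_cancel hp0.ne',
      Real.rpow_one]
  have e2 : a ^ (p - 1) * (s * (L * z ^ (1 - 1 / p))) = (z ^ (1 / p) * a) ^ (p - 1) * (L * s) := by
    rw [Real.mul_rpow (by positivity) ha, ← Real.rpow_mul hz0]
    have : 1 / p * (p - 1) = 1 - 1 / p := by field_simp
    rw [this]
    ring
  have h1 := rpow_sub_one_mul_le hp (a := z ^ (1 / p) * a) (b := L * s) (by positivity)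
    (by positivity)
  have h2 := mul_le_mul_of_nonneg_left (hκ a ha) hz0
  have h3 := hκ (L * s) (by positivity)
  have h4 : z ^ (1 - 1 / p) ≤ 1 := Real.rpow_le_one hz0 hz1 (by
    rw [sub_nonneg, div_le_one hp0]; exact hp.le)
  have h5 : K * (s * (L * z ^ (1 - 1 / p))) ≤ K * (L * s) := by
    have : s * (L * z ^ (1 - 1 / p)) ≤ L * s := by
      have := mul_le_mul_of_nonneg_left h4 (mul_nonneg hL hs)
      linarith
    exact mul_le_mul_of_nonneg_left this hK
  have h6 : z * κ ≤ κ := mul_le_of_le_one_left hκ0 hz1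
  have h7 : 0 ≤ (L * s) ^ p := by positivity
  rw [e2]
  rw [Real.mul_rpow hL hs] at h1 h3 h7
  rw [← e1] at h1
  nlinarith

theorem IsCutoff.norm_grad_le {d : ℕ} {S : Set (E d)} {p L : ℝ} {ζ : E d → ℝ}
    (h : IsCutoff S p L ζ) (hp : 1 < p) (hL : 0 ≤ L) (x : E d) : ‖∇ ζ x‖ ≤ L := by
  refine (h.grad_le x).trans (mul_le_of_le_one_right hL
    (Real.rpow_le_one (h.nonneg x) (h.le_one x) ?_))
  rw [sub_nonneg, div_le_one (by linarith)]
  exact hp.le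

theorem IsCutoff.grad_eq_zero {d : ℕ} {S : Set (E d)} {p L : ℝ} {ζ : E d → ℝ}
    (h : IsCutoff S p L ζ) (hp : 1 < p) {x : E d} (hx : x ∉ S) : ∇ ζ x = 0 := by
  have := h.grad_le x
  rw [h.eq_zero x hx, Real.zero_rpow, mul_zero] at this
  · exact norm_le_zero_iff.1 this
  · have : 1 / p < 1 := by rw [div_lt_one (by linarith)]; exact hp
    linarith

theorem IsTruncation.memLp_comp {ψ χ : ℝ → ℝ} (hψ : IsTruncation ψ χ) {α : Type*}
    [MeasurableSpace α] {μ : Measure α} {q : ℝ≥0∞} {u : α → ℝ} (hu : MemLp u q μ) :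
    MemLp (fun x => ψ (u x)) q μ :=
  hu.mono (hψ.measurable.1.comp_aemeasurable hu.1.aemeasurable).aestronglyMeasurable
    (.of_forall fun _ => hψ.abs_le _)

theorem IsTruncation.memLp_grad {ψ χ : ℝ → ℝ} (hψ : IsTruncation ψ χ) {d : ℕ} {Ω : Set (E d)}
    {q : ℝ≥0∞} {μ : Measure (E d)} {u : E d → ℝ} {Du : E d → E d} (hu : MemLp u q μ)
    (hDu : MemLp Du q μ) {ζ : E d → ℝ} (hζ : IsTestFunction Ω ζ) :
    MemLp (fun x => (ζ x * χ (u x)) • Du x + ψ (u x) • ∇ ζ x) q μ := by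
  obtain ⟨B, hB0, hB⟩ := hζ.exists_bound
  have hζm : AEStronglyMeasurable ζ μ := hζ.contDiff_one.continuous.aestronglyMeasurable
  have m2 : AEStronglyMeasurable (fun x => χ (u x)) μ :=
    (hψ.measurable.2.comp_aemeasurable hu.1.aemeasurable).aestronglyMeasurable
  have h1 := hψ.memLp_comp hu
  refine MemLp.add ?_ ?_
  · refine (hDu.const_smul B).mono ((hζm.mul m2).smul hDu.1) (.of_forall fun x => ?_)
    rw [Pi.smul_apply, norm_smul, norm_smul, norm_mul, Real.norm_of_nonneg hB0.le]
    have e : ‖ζ x‖ * ‖χ (u x)‖ ≤ B * 1 := by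
      refine mul_le_mul (hB x).1 ?_ (norm_nonneg _) hB0.le
      rw [Real.norm_of_nonneg (hψ.nonneg _)]
      exact hψ.le_one _
    rw [mul_one] at e
    exact mul_le_mul_of_nonneg_right e (norm_nonneg _)
  · refine (h1.const_smul B).mono
      (h1.1.smul (continuous_gradient hζ.contDiff_one).aestronglyMeasurable)
      (.of_forall fun x => ?_)
    rw [Pi.smul_apply, norm_smul, norm_smul, Real.norm_of_nonneg hB0.le, mul_comm]
    exact mul_le_mul_of_nonneg_right (hB x).2 (norm_nonneg _)

/-- The Caccioppoli inequality. -/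
theorem FluxBounded.caccioppoli {d : ℕ} {Ω S : Set (E d)} [IsFiniteMeasure (volume.restrict Ω)]
    (hSΩ : S ⊆ Ω) {p K κ L : ℝ} (hp : 1 < p) {u : E d → ℝ} {Du : E d → E d}
    (h : FluxBounded Ω p K u Du) (hK : 0 ≤ K) (hκ0 : 0 ≤ κ)
    (hκ : ∀ t : ℝ, 0 ≤ t → K * t ≤ t ^ p / 4 + κ) {ψ χ : ℝ → ℝ} (hψ : IsTruncation ψ χ)
    {ζ : E d → ℝ} (hζt : IsTestFunction Ω ζ) (hL : 0 ≤ L) (hζ : IsCutoff S p L ζ) :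
    ∫ x in S, ζ x * χ (u x) * ‖Du x‖ ^ p ≤
      2 * (4 ^ (p - 1) + 1) * L ^ p * (∫ x in S, |ψ (u x)| ^ p) +
        4 * κ * ∫ x in S, χ (u x) := by
  have hp0 : 0 < p := by linarith
  have hq : 1 ≤ ENNReal.ofReal p := by simpa using hp.le
  have hq0 : ENNReal.ofReal p ≠ 0 := (zero_lt_one.trans_le hq).ne'
  set Dw : E d → E d := fun x => (ζ x * χ (u x)) • Du x + ψ (u x) • ∇ ζ x with hDwdef
  have hDw : MemLp Dw (ENNReal.ofReal p) (volume.restrict Ω) :=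
    hψ.memLp_grad h.memLp h.memLp_grad hζt
  have hb := h.bound_of_approx hp hDw (hψ.exists_testApprox hp.le h.memLp h.memLp_grad h.approx hζt)
  have hz : ∀ x ∉ S, Dw x = 0 := fun x hx => by
    simp [hDwdef, hζ.eq_zero x hx, hζ.grad_eq_zero hp hx]
  have hrs : (volume.restrict Ω).restrict S = volume.restrict S :=
    Measure.restrict_restrict_of_subset hSΩ
  have hΩS : ∀ g : E d → ℝ, (∀ x ∉ S, g x = 0) → ∫ x in Ω, g x = ∫ x in S, g x := fun g hg => by
    rw [← hrs, setIntegral_eq_integral_of_forall_compl_eq_zero hg]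
  rw [hΩS _ (fun x hx => by rw [hz x hx, inner_zero_right]),
    hΩS _ (fun x hx => by rw [hz x hx, norm_zero])] at hb
  have hle : volume.restrict S ≤ volume.restrict Ω := Measure.restrict_mono hSΩ le_rfl
  have hfin : IsFiniteMeasure (volume.restrict S) := isFiniteMeasure_of_le _ hle
  have hu := h.memLp.mono_measure hle
  have hDu := h.memLp_grad.mono_measure hle
  have hDw' := hDw.mono_measure hle
  have hζm : AEStronglyMeasurable ζ (volume.restrict S) :=
    hζt.contDiff_one.continuous.aestronglyMeasurable
  have mχ : AEStronglyMeasurable (fun x => χ (u x)) (volume.restrict S) :=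
    (hψ.measurable.2.comp_aemeasurable hu.1.aemeasurable).aestronglyMeasurable
  have iχ : Integrable (fun x => χ (u x)) (volume.restrict S) := by
    refine (integrable_const (1 : ℝ)).mono mχ (.of_forall fun x => ?_)
    rw [Real.norm_of_nonneg (hψ.nonneg _), norm_one]
    exact hψ.le_one _
  have iD : Integrable (fun x => ‖Du x‖ ^ p) (volume.restrict S) := by
    have := hDu.integrable_norm_rpow hq0 ENNReal.ofReal_ne_top
    rwa [ENNReal.toReal_ofReal hp0.le] at this
  have iψ : Integrable (fun x => |ψ (u x)| ^ p) (volume.restrict S) := by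
    have := (hψ.memLp_comp hu).integrable_norm_rpow hq0 ENNReal.ofReal_ne_top
    rwa [ENNReal.toReal_ofReal hp0.le] at this
  have i1 : Integrable (fun x => ζ x * χ (u x) * ‖Du x‖ ^ p) (volume.restrict S) := by
    refine iD.mono ((hζm.mul mχ).mul iD.1) (.of_forall fun x => ?_)
    rw [norm_mul, Real.norm_of_nonneg (mul_nonneg (hζ.nonneg x) (hψ.nonneg _))]
    exact mul_le_of_le_one_left (norm_nonneg _)
      (mul_le_one₀ (hζ.le_one x) (hψ.nonneg _) (hψ.le_one _))
  have i2 := integrable_inner_flux hp hDu hDw'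
  have i3 : Integrable (fun x => ‖Dw x‖) (volume.restrict S) := (hDw'.integrable hq).norm
  -- By `hb`, the bound tested with ζψ(u), the right side is at most zero; doubling then gives the
  -- claim.
  have key : ∫ x in S, (ζ x * χ (u x) * ‖Du x‖ ^ p / 2 -
      (4 ^ (p - 1) + 1) * L ^ p * |ψ (u x)| ^ p - 2 * κ * χ (u x)) ≤
      ∫ x in S, ((inner ℝ (flux (fun t : ℝ => t ^ (p - 1)) (Du x)) (Dw x) : ℝ) - K * ‖Dw x‖) := by
    refine integral_mono (((i1.div_const 2).sub (iψ.const_mul _)).sub (iχ.const_mul _))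
      (i2.sub (i3.const_mul K)) fun x => ?_
    have hin : (inner ℝ (flux (fun t : ℝ => t ^ (p - 1)) (Du x)) (Dw x) : ℝ) =
        ζ x * χ (u x) * ‖Du x‖ ^ p +
          ψ (u x) * inner ℝ (flux (fun t : ℝ => t ^ (p - 1)) (Du x)) (∇ ζ x) := by
      rw [hDwdef, inner_add_right, inner_smul_right, inner_smul_right, inner_flux_self hp0]
    -- Where χ = 0 also ψ = 0, so `Dw` and both integrands vanish; hence κ is paid only on the
    -- active set.
    rcases hψ.zero_or_one (u x) with h0 | h1
    · simp [h0, hψ.eq_zero _ h0, hDwdef, Real.zero_rpow hp0.ne']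
    · have e := energy_pointwise hp hκ hK hκ0 hL (hζ.nonneg x) (hζ.le_one x) (norm_nonneg (Du x))
        (abs_nonneg (ψ (u x)))
      simp only [hin, h1, mul_one]
      refine e.trans (sub_le_sub ?_ ?_)
      · rw [sub_eq_add_neg]
        refine add_le_add le_rfl (neg_le_of_abs_le ?_)
        rw [abs_mul]
        have hcs := abs_real_inner_le_norm (flux (fun t : ℝ => t ^ (p - 1)) (Du x)) (∇ ζ x)
        calc _ ≤ |ψ (u x)| * (‖Du x‖ ^ (p - 1) * (L * ζ x ^ (1 - 1 / p))) := by
              refine mul_le_mul_of_nonneg_left (hcs.trans ?_) (abs_nonneg _)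
              exact mul_le_mul (norm_flux_le p _) (hζ.grad_le x) (norm_nonneg _) (by positivity)
          _ = _ := by ring
      · refine mul_le_mul_of_nonneg_left ?_ hK
        simp only [hDwdef, h1, mul_one]
        refine (norm_add_le _ _).trans (add_le_add ?_ ?_)
        · rw [norm_smul, Real.norm_of_nonneg (hζ.nonneg x)]
        · rw [norm_smul, Real.norm_eq_abs]
          exact mul_le_mul_of_nonneg_left (hζ.grad_le x) (abs_nonneg _)
  have i4 : Integrable (fun x => ζ x * χ (u x) * ‖Du x‖ ^ p / 2 -
      (4 ^ (p - 1) + 1) * L ^ p * |ψ (u x)| ^ p) (volume.restrict S) :=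
    (i1.div_const 2).sub (iψ.const_mul _)
  rw [integral_sub i2 (i3.const_mul K), integral_const_mul, integral_sub i4 (iχ.const_mul _),
    integral_sub (i1.div_const 2) (iψ.const_mul _), integral_const_mul, integral_const_mul,
    integral_div] at key
  linarith

/-! ### Sobolev and Poincaré inequalities. -/

/-- The Gagliardo-Nirenberg-Sobolev inequality with exponent `1`, including dimension one. -/
theorem exists_sobolev_const {d : ℕ} (hd : 1 ≤ d) : ∃ (C : ℝ≥0) (q : ℝ≥0∞), 1 ≤ q ∧
    1 / (1 : ℝ≥0∞).toReal - 1 / q.toReal = 1 / d ∧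
    ∀ φ : E d → ℝ, ContDiff ℝ 1 φ → HasCompactSupport φ →
      eLpNorm φ q volume ≤ C * ∫⁻ x, ‖fderiv ℝ φ x‖ₑ := by
  rcases hd.lt_or_eq with h2 | rfl
  · have hd1 : (1 : ℝ≥0) < d := by exact_mod_cast h2
    have hc : NNReal.HolderConjugate (Module.finrank ℝ (E d)) (NNReal.conjExponent d) := by
      rw [finrank_euclideanSpace_fin]
      exact NNReal.HolderConjugate.conjExponent hd1
    refine ⟨eLpNormLESNormFDerivOneConst (volume : Measure (E d)) (NNReal.conjExponent d),
      NNReal.conjExponent d, ?_, ?_, fun φ h1 h2 => ?_⟩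
    · exact_mod_cast hc.symm.lt.le
    · have := hc.coe.inv_add_inv_eq_one
      rw [finrank_euclideanSpace_fin] at this
      simp only [ENNReal.toReal_one, ENNReal.coe_toReal, one_div, inv_one]
      push_cast at this
      linarith
    · have := eLpNorm_le_eLpNorm_fderiv_one (volume : Measure (E d)) h1 h2 hc
      rwa [eLpNorm_one_eq_lintegral_enorm] at this
  -- In dimension one q = ∞ works: the supremum is at most the total variation. The exponent
  -- relation persists because `(⊤ : ℝ≥0∞).toReal = 0` and 1/0 = 0 in ℝ.
  · refine ⟨1, ⊤, le_top, by simp, fun φ h1 h2 => ?_⟩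
    rw [eLpNorm_exponent_top]
    refine essSup_le_of_ae_le _ (.of_forall fun x => ?_)
    have e := enorm_slice_le 0 h1 h2 (dropCoord 0 x) (x 0)
    have hv : (volume : Measure (E 0)) univ = 1 := by
      have h0 := (PiLp.volume_preserving_ofLp (Fin 0)).measure_preimage
        MeasurableSet.univ.nullMeasurableSet
      rw [preimage_univ] at h0
      rw [h0, volume_pi, Measure.pi_of_empty]
      simp
    have e2 : ∫⁻ s, ‖fderiv ℝ φ (slice 0 (dropCoord 0 x) s)‖ₑ = ∫⁻ x, ‖fderiv ℝ φ x‖ₑ := by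
      rw [← lintegral_slice (n := 0) 0 (h1.continuous_fderiv one_ne_zero).enorm.measurable]
      have : ∀ y : E 0, y = dropCoord 0 x := fun y => Subsingleton.elim _ _
      calc _ = ∫⁻ _ : E 0, ∫⁻ s, ‖fderiv ℝ φ (slice 0 (dropCoord 0 x) s)‖ₑ := by
            rw [lintegral_const, hv, mul_one]
        _ = _ := lintegral_congr fun y => by rw [this y]
    rw [slice_dropCoord, e2] at e
    simpa using e

/-- A Poincaré inequality on `W_0^{1,p}(Ω)`, for functions vanishing outside a small set. -/
theorem poincare {d : ℕ} {C : ℝ≥0} {q : ℝ≥0∞} (hq : 1 ≤ q)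
    (hqd : 1 / (1 : ℝ≥0∞).toReal - 1 / q.toReal = 1 / d)
    (hC : ∀ φ : E d → ℝ, ContDiff ℝ 1 φ → HasCompactSupport φ →
      eLpNorm φ q volume ≤ C * ∫⁻ x, ‖fderiv ℝ φ x‖ₑ)
    {Ω : Set (E d)} {p : ℝ} (hp : 1 < p) {w : E d → ℝ} {Dw : E d → E d}
    (hw : MemLp w (ENNReal.ofReal p) (volume.restrict Ω))
    (hDw : MemLp Dw (ENNReal.ofReal p) (volume.restrict Ω))
    (ha : ∃ φ, TestApprox Ω p w Dw φ) :
    eLpNorm w (ENNReal.ofReal p) (volume.restrict Ω) ≤ C * ENNReal.ofReal p *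
      (volume.restrict Ω) {x | w x ≠ 0} ^ (1 / d : ℝ) *
        eLpNorm Dw (ENNReal.ofReal p) (volume.restrict Ω) := by
  set μ := volume.restrict Ω with hμ
  set P := ENNReal.ofReal p with hP
  have hp0 : 0 < p := by linarith
  have hP1 : 1 ≤ P := by simpa [hP] using hp.le
  obtain ⟨φ₀, hφ₀⟩ := ha
  obtain ⟨φ, hφ, hae⟩ := hφ₀.exists_ae_tendsto hp0 hw.1
  have hm : ∀ n, MemLp (φ n) P μ ∧ MemLp (∇ (φ n)) P μ := fun n =>
    ⟨(memW01p_of_test (hφ.test n)).1.1.memLp, (memW01p_of_test (hφ.test n)).1.1.memLp_grad⟩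
  set a : ℕ → ℝ≥0∞ := fun n => eLpNorm w P μ + eLpNorm (fun x => w x - φ n x) P μ with haDef
  set b : ℕ → ℝ≥0∞ := fun n => eLpNorm Dw P μ + eLpNorm (fun x => Dw x - ∇ (φ n) x) P μ with hbDef
  have hta : Tendsto a atTop (𝓝 (eLpNorm w P μ)) := by
    simpa using (tendsto_const_nhds (x := eLpNorm w P μ)).add hφ.tendsto
  have htb : Tendsto b atTop (𝓝 (eLpNorm Dw P μ)) := by
    simpa using (tendsto_const_nhds (x := eLpNorm Dw P μ)).add hφ.tendsto_grad
  -- The W^{1,1} Sobolev inequality is applied to |φ_n|^p, whose gradient is at most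
  -- p|φ_n|^{p-1}|∇φ_n|, followed by Hölder. The numbers `a n`, `b n` dominate the norms of φ_n and
  -- ∇φ_n and converge to those of w and Dw; Fatou's lemma then gives `hlim`.
  have hsmooth : ∀ n, eLpNorm (fun x => ‖φ n x‖ ^ p) q μ ≤
      C * (ENNReal.ofReal p * (b n * a n ^ (p - 1))) := fun n => by
    have hc1 := (hφ.test n).contDiff_one
    have h1 : ContDiff ℝ 1 fun x => ‖φ n x‖ ^ p := hc1.norm_rpow hp
    have h2 : HasCompactSupport fun x => ‖φ n x‖ ^ p :=
      (hφ.test n).compact.comp_left (g := fun t : ℝ => ‖t‖ ^ p) (by simp [Real.zero_rpow hp0.ne'])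
    refine (eLpNorm_mono_measure _ Measure.restrict_le_self).trans ((hC _ h1 h2).trans ?_)
    gcongr
    have hfd : ∀ x, ‖fderiv ℝ (fun x => ‖φ n x‖ ^ p) x‖ₑ ≤
        ENNReal.ofReal p * (‖∇ (φ n) x‖ₑ * ‖φ n x‖ₑ ^ (p - 1)) := fun x => by
      have e := enorm_fderiv_norm_rpow_le (hc1.differentiable one_ne_zero) (x := x)
        (p := p.toNNReal) (by simpa using hp)
      rw [Real.coe_toNNReal _ hp0.le] at e
      refine e.trans (le_of_eq ?_)
      rw [← ofReal_norm (∇ (φ n) x), norm_gradient_eq, ofReal_norm, ENNReal.ofReal]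
      ring
    have hsub : Function.support (fun x => ‖∇ (φ n) x‖ₑ * ‖φ n x‖ₑ ^ (p - 1)) ⊆ Ω := by
      intro x hx
      by_contra h
      have h0 : ∇ (φ n) x = 0 := image_eq_zero_of_notMem_tsupport fun h' =>
        h ((hφ.test n).subset (tsupport_gradient_subset _ h'))
      exact hx (by simp [h0])
    calc ∫⁻ x, ‖fderiv ℝ (fun x => ‖φ n x‖ ^ p) x‖ₑ
        ≤ ∫⁻ x, ENNReal.ofReal p * (‖∇ (φ n) x‖ₑ * ‖φ n x‖ₑ ^ (p - 1)) := lintegral_mono hfd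
      _ = ENNReal.ofReal p * ∫⁻ x, ‖∇ (φ n) x‖ₑ * ‖φ n x‖ₑ ^ (p - 1) :=
          lintegral_const_mul' _ _ ENNReal.ofReal_ne_top
      _ = ENNReal.ofReal p * ∫⁻ x, ‖∇ (φ n) x‖ₑ * ‖φ n x‖ₑ ^ (p - 1) ∂μ := by
          rw [hμ, setLIntegral_eq_of_support_subset hsub]
      _ ≤ _ := by
          gcongr
          refine (lintegral_enorm_mul_rpow_le hp (hm n).2.1 (hm n).1.1).trans ?_
          have e1 : eLpNorm (φ n) P μ ≤ a n := by
            refine eLpNorm_le_add_of_norm_le hP1 hw.1 (hw.sub (hm n).1).1 (.of_forall fun x => ?_)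
            have := norm_sub_le (w x) (w x - φ n x)
            simpa using this
          have e2 : eLpNorm (∇ (φ n)) P μ ≤ b n := by
            refine eLpNorm_le_add_of_norm_le hP1 hDw.1 (hDw.sub (hm n).2).1
              (.of_forall fun x => ?_)
            have := norm_sub_le (Dw x) (Dw x - ∇ (φ n) x)
            simpa using this
          exact mul_le_mul' e2 (ENNReal.rpow_le_rpow e1 (by linarith))
  have hlim : eLpNorm (fun x => ‖w x‖ ^ p) q μ ≤
      C * (ENNReal.ofReal p * (eLpNorm Dw P μ * eLpNorm w P μ ^ (p - 1))) := by
    have hwp := ENNReal.rpow_lt_top_of_nonneg (show 0 ≤ p - 1 by linarith) hw.2.ne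
    have ht : Tendsto (fun n => (C : ℝ≥0∞) * (ENNReal.ofReal p * (b n * a n ^ (p - 1)))) atTop
        (𝓝 (C * (ENNReal.ofReal p * (eLpNorm Dw P μ * eLpNorm w P μ ^ (p - 1))))) := by
      refine ENNReal.Tendsto.const_mul (ENNReal.Tendsto.const_mul (ENNReal.Tendsto.mul htb ?_
        (hta.ennrpow_const (p - 1)) ?_) ?_) ?_
      · exact Or.inr hwp.ne
      · exact Or.inr hDw.2.ne
      · exact Or.inr ENNReal.ofReal_ne_top
      · exact Or.inr ENNReal.coe_ne_top
    refine (Lp.eLpNorm_lim_le_liminf_eLpNorm (f := fun n x => ‖φ n x‖ ^ p)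
      (fun n => ((hφ.test n).contDiff_one.norm_rpow hp).continuous.aestronglyMeasurable) _
      ?_).trans ((liminf_le_liminf (.of_forall hsmooth)).trans ht.liminf_eq.le)
    filter_upwards [hae] with x hx
    exact hx.norm.rpow_const (Or.inr hp0.le)
  set S := {x | w x ≠ 0} with hS
  have hint : eLpNorm w P μ ^ p = ∫⁻ x, ‖w x‖ₑ ^ p ∂μ := by
    rw [eLpNorm_eq_lintegral_rpow_enorm_toReal (zero_lt_one.trans_le hP1).ne'
      ENNReal.ofReal_ne_top, hP, ENNReal.toReal_ofReal hp0.le, ← ENNReal.rpow_mul,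
      one_div_mul_cancel hp0.ne', ENNReal.rpow_one]
  have hmeas : AEStronglyMeasurable (fun x => ‖w x‖ ^ p) (μ.restrict S) :=
    ((hw.1.norm.aemeasurable.pow_const p).aestronglyMeasurable).restrict
  -- Hölder from L^q to L^1 on the set where w ≠ 0 produces the power 1/d of its measure.
  have hmain : eLpNorm w P μ ^ p ≤ C * (ENNReal.ofReal p *
      (eLpNorm Dw P μ * eLpNorm w P μ ^ (p - 1))) * μ S ^ (1 / d : ℝ) := by
    have hh := eLpNorm_le_eLpNorm_mul_rpow_measure_univ hq hmeas
    rw [hqd, Measure.restrict_apply_univ, eLpNorm_one_eq_lintegral_enorm] at hh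
    refine le_trans (le_of_eq ?_) (hh.trans (mul_le_mul_left
      ((eLpNorm_mono_measure _ Measure.restrict_le_self).trans hlim) _))
    have hsub : Function.support (fun x => ‖‖w x‖ ^ p‖ₑ) ⊆ S := fun x hx h =>
      hx (by simp [h, Real.zero_rpow hp0.ne'])
    rw [hint, setLIntegral_eq_of_support_subset hsub]
    refine lintegral_congr fun x => ?_
    rw [Real.enorm_rpow_of_nonneg (norm_nonneg _) hp0.le, enorm_norm]
  -- The factor ‖w‖^{p-1} is cancelled from both sides, which requires it to be nonzero and finite.
  rcases eq_or_ne (eLpNorm w P μ) 0 with h0 | h0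
  · rw [h0]
    exact zero_le
  have hne0 : eLpNorm w P μ ^ (p - 1) ≠ 0 := by
    simp [ENNReal.rpow_eq_zero_iff, h0, hw.2.ne]
  have hnet : eLpNorm w P μ ^ (p - 1) ≠ ⊤ :=
    (ENNReal.rpow_lt_top_of_nonneg (by linarith) hw.2.ne).ne
  have hsplit : eLpNorm w P μ ^ p = eLpNorm w P μ * eLpNorm w P μ ^ (p - 1) := by
    conv_lhs => rw [show p = 1 + (p - 1) by ring]
    rw [ENNReal.rpow_add _ _ h0 hw.2.ne, ENNReal.rpow_one]
  rw [hsplit] at hmain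
  refine (ENNReal.mul_le_mul_iff_left hne0 hnet).1 (hmain.trans (le_of_eq ?_))
  ring

/-! ### Cut-off functions. -/

/-- Cut-off functions between concentric balls. -/
theorem exists_cutoff {p : ℝ} (hp : 1 < p) : ∃ c : ℝ, 0 < c ∧ ∀ {d : ℕ} {Ω : Set (E d)} {x₀ : E d}
    {ρ r : ℝ}, 0 < ρ → ρ < r → closedBall x₀ r ⊆ Ω → ∃ ζ : E d → ℝ, IsTestFunction Ω ζ ∧
      IsCutoff (ball x₀ r) p (c / (r - ρ)) ζ ∧ ∀ x ∈ ball x₀ ρ, ζ x = 1 := by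
  obtain ⟨S, hS0, hS, -, -⟩ := exists_abs_deriv_smoothTransition_le
  have hp0 : 0 < p := by linarith
  -- The cut-off is η^m. Its gradient carries η^{m-1}, which is at most (η^m)^{1-1/p} because m ≥ p
  -- and η ≤ 1.
  set m := ⌈p⌉₊ with hm
  have hpm : p ≤ m := Nat.le_ceil p
  have hm2 : 2 ≤ m := by
    have : (1 : ℝ) < m := hp.trans_le hpm
    exact_mod_cast this
  -- The factor m is from the power, S bounds the derivative of the smooth step, and 2/(r - ρ)
  -- bounds the gradient of `g`, since 2r/(r² - ρ²) ≤ 2/(r - ρ). Squared distances keep `g` smooth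
  -- at the centre.
  refine ⟨m * S * 2, by positivity, fun {d Ω x₀ ρ r} hρ hr hΩ => ?_⟩
  have hr0 : 0 < r := hρ.trans hr
  have hD : 0 < r ^ 2 - ρ ^ 2 := by nlinarith
  set g : E d → ℝ := fun x => (r ^ 2 - ‖x - x₀‖ ^ 2) / (r ^ 2 - ρ ^ 2) with hg
  set η : E d → ℝ := fun x => Real.smoothTransition (g x) with hη
  have hgs : ContDiff ℝ ∞ g :=
    (contDiff_const.sub ((contDiff_id.sub contDiff_const).norm_sq ℝ)).div_const _
  have hηs : ContDiff ℝ ∞ η := Real.smoothTransition.contDiff.comp hgs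
  have hη0 : ∀ x, 0 ≤ η x := fun x => Real.smoothTransition.nonneg _
  have hη1 : ∀ x, η x ≤ 1 := fun x => Real.smoothTransition.le_one _
  have hzero : ∀ x ∉ ball x₀ r, η x = 0 := fun x hx => by
    rw [mem_ball, dist_eq_norm, not_lt] at hx
    refine Real.smoothTransition.zero_of_nonpos (div_nonpos_of_nonpos_of_nonneg ?_ hD.le)
    nlinarith
  have hsub : tsupport (fun x => η x ^ m) ⊆ closedBall x₀ r := by
    refine closure_minimal (fun x hx => ?_) isClosed_closedBall
    by_contra h
    exact hx (by simp only [hzero x (fun h' => h (ball_subset_closedBall h'))]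
                 exact zero_pow (by omega))
  refine ⟨fun x => η x ^ m, ⟨hηs.pow m, HasCompactSupport.of_support_subset_isCompact
    (isCompact_closedBall x₀ r) (subset_closure.trans hsub), hsub.trans hΩ⟩,
    ⟨fun x => pow_nonneg (hη0 x) m, fun x => pow_le_one₀ (hη0 x) (hη1 x), fun x => ?_,
      fun x hx => ?_⟩, fun x hx => ?_⟩
  · have hc0 : 0 ≤ m * S * 2 / (r - ρ) := div_nonneg (by positivity) (by linarith)
    set G : E d →L[ℝ] ℝ := -(2 • (innerSL ℝ (x - x₀)))
    have hgd : HasFDerivAt g ((r ^ 2 - ρ ^ 2)⁻¹ • G) x := by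
      have h1 : HasFDerivAt (fun y : E d => ‖y - x₀‖ ^ 2) (2 • (innerSL ℝ (x - x₀))) x := by
        have := (hasStrictFDerivAt_norm_sq (x - x₀)).hasFDerivAt.comp x
          ((hasFDerivAt_id x).sub_const x₀)
        rwa [ContinuousLinearMap.comp_id] at this
      have h2 := (h1.const_sub (r ^ 2)).const_smul (r ^ 2 - ρ ^ 2)⁻¹
      refine h2.congr_of_eventuallyEq (.of_forall fun y => ?_)
      simp [hg, div_eq_inv_mul]
    have hηd := ((Real.smoothTransition.contDiff (n := 1)).differentiable one_ne_zero
      (g x)).hasDerivAt.comp_hasFDerivAt x hgd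
    have hd := hηd.pow m
    have hfd : fderiv ℝ (fun x => η x ^ m) x = (m * η x ^ (m - 1) *
        deriv Real.smoothTransition (g x)) • ((r ^ 2 - ρ ^ 2)⁻¹ • G) := by
      refine hd.fderiv.trans ?_
      rw [smul_smul, nsmul_eq_mul]
      rfl
    have hpow : (η x) ^ (m - 1) ≤ ((η x) ^ m) ^ (1 - 1 / p) := by
      rw [← Real.rpow_natCast (η x) m, ← Real.rpow_mul (hη0 x), ← Real.rpow_natCast]
      have h1 : 1 / p < 1 := by rw [div_lt_one hp0]; exact hp
      refine Real.rpow_le_rpow_of_exponent_ge' (hη0 x) (hη1 x)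
        (mul_nonneg m.cast_nonneg (by linarith)) ?_
      rw [Nat.cast_sub (by omega), mul_sub, mul_one_div, mul_one, Nat.cast_one]
      have : 1 ≤ m / p := by rw [le_div_iff₀ hp0]; linarith
      linarith
    by_cases hx : x ∈ ball x₀ r
    · rw [mem_ball, dist_eq_norm] at hx
      have hgn : ‖(r ^ 2 - ρ ^ 2)⁻¹ • G‖ ≤ 2 / (r - ρ) := by
        have e : ‖(2 • (innerSL ℝ (x - x₀)) : E d →L[ℝ] ℝ)‖ ≤ 2 * r := by
          rw [two_smul]
          refine (norm_add_le _ _).trans ?_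
          rw [innerSL_apply_norm]
          linarith
        rw [norm_smul, norm_neg, Real.norm_of_nonneg (by positivity)]
        calc _ ≤ (r ^ 2 - ρ ^ 2)⁻¹ * (2 * r) := by gcongr
          _ ≤ 2 / (r - ρ) := by
            rw [← div_eq_inv_mul, div_le_div_iff₀ hD (by linarith)]
            nlinarith
      rw [norm_gradient_eq, hfd, norm_smul, norm_mul, mul_assoc]
      have e1 : ‖deriv Real.smoothTransition (g x)‖ ≤ S := hS _
      have e2 : ‖m * η x ^ (m - 1)‖ = m * η x ^ (m - 1) := by
        rw [Real.norm_of_nonneg (mul_nonneg m.cast_nonneg (pow_nonneg (hη0 x) _))]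
      calc _ ≤ (m * η x ^ (m - 1)) * (S * (2 / (r - ρ))) :=
            mul_le_mul e2.le (mul_le_mul e1 hgn (norm_nonneg _) hS0.le) (by positivity)
              (mul_nonneg m.cast_nonneg (pow_nonneg (hη0 x) _))
        _ = m * S * 2 / (r - ρ) * η x ^ (m - 1) := by ring
        _ ≤ _ := mul_le_mul_of_nonneg_left hpow hc0
    · rw [norm_gradient_eq, hfd]
      rw [hzero x hx, zero_pow (by omega), mul_zero, zero_mul, zero_smul, norm_zero]
      exact mul_nonneg hc0 (Real.rpow_nonneg (pow_nonneg le_rfl m) _)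
  · simp only [hzero x hx]
    exact zero_pow (by omega)
  · rw [mem_ball, dist_eq_norm] at hx
    have : η x = 1 := by
      refine Real.smoothTransition.one_of_one_le ?_
      rw [le_div_iff₀ hD]
      nlinarith [norm_nonneg (x - x₀)]
    simp only [this, one_pow]

theorem toReal_eLpNorm_eq {α F : Type*} [MeasurableSpace α] {μ : Measure α}
    [NormedAddCommGroup F] {p : ℝ} (hp : 0 < p) {f : α → F}
    (hf : MemLp f (ENNReal.ofReal p) μ) :
    eLpNorm f (ENNReal.ofReal p) μ = ENNReal.ofReal ((∫ x, ‖f x‖ ^ p ∂μ) ^ p⁻¹) := by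
  rw [hf.eLpNorm_eq_integral_rpow_norm (by simpa using hp) ENNReal.ofReal_ne_top,
    ENNReal.toReal_ofReal hp.le]

/-- The Poincaré inequality in terms of integrals. -/
theorem poincare_integral {d : ℕ} {C : ℝ≥0} {q : ℝ≥0∞} (hq : 1 ≤ q)
    (hqd : 1 / (1 : ℝ≥0∞).toReal - 1 / q.toReal = 1 / d)
    (hC : ∀ φ : E d → ℝ, ContDiff ℝ 1 φ → HasCompactSupport φ →
      eLpNorm φ q volume ≤ C * ∫⁻ x, ‖fderiv ℝ φ x‖ₑ)
    {Ω : Set (E d)} {p : ℝ} (hp : 1 < p) {w : E d → ℝ} {Dw : E d → E d}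
    (hw : MemLp w (ENNReal.ofReal p) (volume.restrict Ω))
    (hDw : MemLp Dw (ENNReal.ofReal p) (volume.restrict Ω))
    (ha : ∃ φ, TestApprox Ω p w Dw φ) {m : ℝ} (hm0 : 0 ≤ m)
    (hm : (volume.restrict Ω) {x | w x ≠ 0} ≤ ENNReal.ofReal m) :
    ∫ x in Ω, ‖w x‖ ^ p ≤ (C * p) ^ p * m ^ (p / d) * ∫ x in Ω, ‖Dw x‖ ^ p := by
  have hp0 : 0 < p := by linarith
  have h := poincare hq hqd hC hp hw hDw ha
  have hI : 0 ≤ ∫ x in Ω, ‖w x‖ ^ p := integral_nonneg fun x => by positivity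
  have hJ : 0 ≤ ∫ x in Ω, ‖Dw x‖ ^ p := integral_nonneg fun x => by positivity
  have h2 : ENNReal.ofReal ((∫ x in Ω, ‖w x‖ ^ p) ^ p⁻¹) ≤
      ENNReal.ofReal (C * p * m ^ (1 / d : ℝ) * (∫ x in Ω, ‖Dw x‖ ^ p) ^ p⁻¹) := by
    rw [← toReal_eLpNorm_eq hp0 hw, ENNReal.ofReal_mul (by positivity),
      ENNReal.ofReal_mul (by positivity), ENNReal.ofReal_mul (by positivity),
      ← toReal_eLpNorm_eq hp0 hDw, ENNReal.ofReal_coe_nnreal,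
      ← ENNReal.ofReal_rpow_of_nonneg hm0 (by positivity)]
    refine h.trans ?_
    gcongr
  have h3 := (ENNReal.ofReal_le_ofReal_iff (by positivity)).1 h2
  have h4 := Real.rpow_le_rpow (by positivity) h3 hp0.le
  rw [← Real.rpow_mul hI, inv_mul_cancel₀ hp0.ne', Real.rpow_one,
    Real.mul_rpow (by positivity) (by positivity), Real.mul_rpow (by positivity) (by positivity),
    ← Real.rpow_mul hJ, inv_mul_cancel₀ hp0.ne', Real.rpow_one, ← Real.rpow_mul hm0,
    one_div_mul_eq_div] at h4
  exact h4

/-! ### De Giorgi iteration and the upper bound. -/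

theorem add_rpow_le {p x y : ℝ} (hp : 0 ≤ p) (hx : 0 ≤ x) (hy : 0 ≤ y) :
    (x + y) ^ p ≤ 2 ^ p * (x ^ p + y ^ p) := by
  have h1 : x + y ≤ 2 * max x y := by
    linarith [le_max_left x y, le_max_right x y]
  have h2 : max x y ^ p ≤ x ^ p + y ^ p := by
    rcases max_cases x y with ⟨h, -⟩ | ⟨h, -⟩ <;> rw [h]
    · linarith [Real.rpow_nonneg hy p]
    · linarith [Real.rpow_nonneg hx p]
  calc (x + y) ^ p ≤ (2 * max x y) ^ p := Real.rpow_le_rpow (by positivity) h1 hp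
    _ = 2 ^ p * max x y ^ p := Real.mul_rpow (by norm_num) (le_max_of_le_left hx)
    _ ≤ _ := by gcongr

/-- The level-set quantity `∫_{B_r} (u - k)_+^p`. -/
noncomputable def excess {d : ℕ} (p : ℝ) (u : E d → ℝ) (x₀ : E d) (k r : ℝ) : ℝ :=
  ∫ x in ball x₀ r, max (u x - k) 0 ^ p

theorem excess_nonneg {d : ℕ} (p : ℝ) (u : E d → ℝ) (x₀ : E d) (k r : ℝ) :
    0 ≤ excess p u x₀ k r := integral_nonneg fun x => by positivity

/-- One step of the De Giorgi iteration. -/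
theorem exists_deGiorgi_const {d : ℕ} (hd : 1 ≤ d) {p : ℝ} (hp : 1 < p) : ∃ C₁ : ℝ, 0 < C₁ ∧
    ∀ {Ω : Set (E d)} [IsFiniteMeasure (volume.restrict Ω)] {K κ : ℝ} {u : E d → ℝ}
      {Du : E d → E d}, FluxBounded Ω p K u Du → 0 ≤ K → 0 ≤ κ →
      (∀ t : ℝ, 0 ≤ t → K * t ≤ t ^ p / 4 + κ) →
      ∀ {x₀ : E d} {ρ r h k : ℝ}, 0 < ρ → ρ < r → closedBall x₀ r ⊆ Ω → 0 ≤ h → h < k →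
        excess p u x₀ k ρ ≤ C₁ * (excess p u x₀ h r / (k - h) ^ p) ^ (p / d) *
          (((r - ρ) ^ p)⁻¹ + κ / (k - h) ^ p) * excess p u x₀ h r := by
  obtain ⟨C, q, hq, hqd, hC⟩ := exists_sobolev_const hd
  obtain ⟨c, hc, hcut⟩ := exists_cutoff hp
  have hp0 : 0 < p := by linarith
  set B : ℝ := (2 * (4 ^ (p - 1) + 1) + 1) * c ^ p + 4 with hB
  refine ⟨(C * p) ^ p * 2 ^ p * B + 1, by positivity,
    fun {Ω _ K κ u Du} H hK hκ0 hκ {x₀ ρ r h k} hρ hr hΩ hh hk => ?_⟩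
  have hk0 : 0 ≤ k := hh.trans hk.le
  have hkh : 0 < (k - h) ^ p := Real.rpow_pos_of_pos (by linarith) _
  have hrρ : 0 < r - ρ := by linarith
  obtain ⟨ζ, hζt, hζ, hζ1⟩ := hcut hρ hr hΩ
  set L := c / (r - ρ) with hL
  have hL0 : 0 ≤ L := by positivity
  set S := ball x₀ r with hS
  have hSΩ : S ⊆ Ω := ball_subset_closedBall.trans hΩ
  have hψ := isTruncation_posPart hk0
  set ψ : ℝ → ℝ := fun t => max (t - k) 0 with hψdef
  set χ : ℝ → ℝ := fun t => if k < t then 1 else 0 with hχdef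
  have hq0 : ENNReal.ofReal p ≠ 0 := by simpa using hp0
  have hcacc := H.caccioppoli hSΩ hp hK hκ0 hκ hψ hζt hL0 hζ
  have hDw := hψ.memLp_grad H.memLp H.memLp_grad hζt
  set w : E d → ℝ := fun x => ζ x * ψ (u x) with hwdef
  set Dw : E d → E d := fun x => (ζ x * χ (u x)) • Du x + ψ (u x) • ∇ ζ x with hDwdef
  have mψ := hψ.memLp_comp H.memLp
  have hw : MemLp w (ENNReal.ofReal p) (volume.restrict Ω) := by
    refine mψ.mono (hζt.contDiff_one.continuous.aestronglyMeasurable.mul mψ.1)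
      (.of_forall fun x => ?_)
    rw [norm_mul, Real.norm_of_nonneg (hζ.nonneg x)]
    exact mul_le_of_le_one_left (norm_nonneg _) (hζ.le_one x)
  have hle : volume.restrict S ≤ volume.restrict Ω := Measure.restrict_mono hSΩ le_rfl
  have hfin : IsFiniteMeasure (volume.restrict S) := isFiniteMeasure_of_le _ hle
  have hrs : (volume.restrict Ω).restrict S = volume.restrict S :=
    Measure.restrict_restrict_of_subset hSΩ
  have hΩS : ∀ g : E d → ℝ, (∀ x ∉ S, g x = 0) → ∫ x in Ω, g x = ∫ x in S, g x := fun g hg => by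
    rw [← hrs, setIntegral_eq_integral_of_forall_compl_eq_zero hg]
  have hu := H.memLp.mono_measure hle
  have hDu := H.memLp_grad.mono_measure hle
  have mχ : AEStronglyMeasurable (fun x => χ (u x)) (volume.restrict S) :=
    (hψ.measurable.2.comp_aemeasurable hu.1.aemeasurable).aestronglyMeasurable
  have iχ : Integrable (fun x => χ (u x)) (volume.restrict S) := by
    refine (integrable_const (1 : ℝ)).mono mχ (.of_forall fun x => ?_)
    rw [Real.norm_of_nonneg (hψ.nonneg _), norm_one]
    exact hψ.le_one _
  have ipow : ∀ {F : Type} [NormedAddCommGroup F] {μ : Measure (E d)} {f : E d → F},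
      MemLp f (ENNReal.ofReal p) μ → Integrable (fun x => ‖f x‖ ^ p) μ := fun hf => by
    have := hf.integrable_norm_rpow hq0 ENNReal.ofReal_ne_top
    rwa [ENNReal.toReal_ofReal hp0.le] at this
  have iexc : ∀ l, 0 ≤ l → Integrable (fun x => max (u x - l) 0 ^ p) (volume.restrict S) :=
    fun l hl => by
      have := ipow ((isTruncation_posPart hl).memLp_comp hu)
      simpa only [Real.norm_of_nonneg (le_max_right _ (0 : ℝ))] using this
  set a := ∫ x in S, χ (u x) with ha
  set Y := excess p u x₀ h r with hY
  have ha0 : 0 ≤ a := integral_nonneg fun x => hψ.nonneg _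
  have hY0 : 0 ≤ Y := excess_nonneg _ _ _ _ _
  -- Chebyshev: where u > k, the truncation at the lower level h exceeds k - h. This converts the
  -- measure of the level set into excess and makes the recursion superlinear.
  have haY : a ≤ Y / (k - h) ^ p := by
    rw [le_div_iff₀ hkh, ha, ← integral_mul_const]
    refine integral_mono (iχ.mul_const _) (iexc h hh) fun x => ?_
    simp only [hχdef]
    split_ifs with hx
    · rw [one_mul]
      exact Real.rpow_le_rpow (by linarith) (le_max_of_le_left (by linarith)) hp0.le
    · rw [zero_mul]
      positivity
  have hYk : ∫ x in S, |ψ (u x)| ^ p ≤ Y := by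
    have : ∀ x, |ψ (u x)| ^ p = max (u x - k) 0 ^ p := fun x => by
      rw [abs_of_nonneg (le_max_right _ _)]
    simp only [this]
    refine integral_mono (iexc k hk0) (iexc h hh) fun x => ?_
    exact Real.rpow_le_rpow (le_max_right _ _) (max_le_max (by linarith) le_rfl) hp0.le
  have hmeas : (volume.restrict Ω) {x | w x ≠ 0} ≤ ENNReal.ofReal a := by
    have hsub : {x | w x ≠ 0} ⊆ S := fun x hx => by
      by_contra h'
      exact hx (by simp [hwdef, hζ.eq_zero x h'])
    rw [Measure.restrict_eq_self _ (hsub.trans hSΩ), ← Measure.restrict_eq_self _ hsub, ha,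
      ofReal_integral_eq_lintegral_ofReal iχ (.of_forall fun x => hψ.nonneg _)]
    have := mul_meas_ge_le_lintegral₀ mχ.aemeasurable.ennreal_ofReal 1
    rw [one_mul] at this
    refine (measure_mono fun x hx => ?_).trans this
    rw [mem_ofPred_eq]
    rcases hψ.zero_or_one (u x) with h0 | h1
    · exact absurd (by simp [hwdef, hψ.eq_zero _ h0]) hx
    · simp [h1]
  have hpoin := poincare_integral hq hqd hC hp hw hDw
    (hψ.exists_testApprox hp.le H.memLp H.memLp_grad H.approx hζt) ha0 hmeas
  rw [hΩS _ (fun x hx => by simp [hwdef, hζ.eq_zero x hx, Real.zero_rpow hp0.ne']),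
    hΩS _ (fun x hx => by
      simp [hDwdef, hζ.eq_zero x hx, hζ.grad_eq_zero hp hx, Real.zero_rpow hp0.ne'])] at hpoin
  have hgrad : ∫ x in S, ‖Dw x‖ ^ p ≤ 2 ^ p * ((∫ x in S, ζ x * χ (u x) * ‖Du x‖ ^ p) +
      L ^ p * ∫ x in S, |ψ (u x)| ^ p) := by
    have i1 : Integrable (fun x => ζ x * χ (u x) * ‖Du x‖ ^ p) (volume.restrict S) := by
      refine (ipow hDu).mono ((hζt.contDiff_one.continuous.aestronglyMeasurable.mul mχ).mul
        (ipow hDu).1) (.of_forall fun x => ?_)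
      rw [norm_mul, Real.norm_of_nonneg (mul_nonneg (hζ.nonneg x) (hψ.nonneg _))]
      exact mul_le_of_le_one_left (norm_nonneg _)
        (mul_le_one₀ (hζ.le_one x) (hψ.nonneg _) (hψ.le_one _))
    have i2 : Integrable (fun x => |ψ (u x)| ^ p) (volume.restrict S) :=
      ipow (mψ.mono_measure hle)
    rw [← integral_const_mul, ← integral_add i1 (i2.const_mul _), ← integral_const_mul]
    refine integral_mono (ipow (hDw.mono_measure hle)) ((i1.add (i2.const_mul _)).const_mul _)
      fun x => ?_
    have hz0 := mul_nonneg (hζ.nonneg x) (hψ.nonneg (u x))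
    have hz1 : ζ x * χ (u x) ≤ 1 := mul_le_one₀ (hζ.le_one x) (hψ.nonneg _) (hψ.le_one _)
    have e1 : ‖Dw x‖ ≤ ζ x * χ (u x) * ‖Du x‖ + L * |ψ (u x)| := by
      refine (norm_add_le _ _).trans (add_le_add ?_ ?_)
      · rw [norm_smul, Real.norm_of_nonneg hz0]
      · rw [norm_smul, Real.norm_eq_abs, mul_comm]
        exact mul_le_mul_of_nonneg_right (hζ.norm_grad_le hp hL0 x) (abs_nonneg _)
    refine (Real.rpow_le_rpow (norm_nonneg _) e1 hp0.le).trans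
      ((add_rpow_le hp0.le (by positivity) (by positivity)).trans ?_)
    rw [Real.mul_rpow hz0 (norm_nonneg _), Real.mul_rpow hL0 (abs_nonneg _)]
    -- A number in [0,1] decreases under a power p ≥ 1, so the Caccioppoli integrand, linear in ζχ,
    -- suffices.
    have e2 : (ζ x * χ (u x)) ^ p ≤ ζ x * χ (u x) := by
      simpa using Real.rpow_le_rpow_of_exponent_ge' hz0 hz1 zero_le_one hp.le
    gcongr
  have hfirst : excess p u x₀ k ρ ≤ ∫ x in S, ‖w x‖ ^ p := by
    have hsub : ball x₀ ρ ⊆ S := ball_subset_ball hr.le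
    refine le_trans ?_ (setIntegral_mono_set (ipow (hw.mono_measure hle))
      (.of_forall fun x => by positivity) (LE.le.eventuallyLE hsub))
    refine le_of_eq (setIntegral_congr_fun measurableSet_ball fun x hx => ?_)
    simp only [hwdef, hζ1 x hx, one_mul, hψdef, Real.norm_of_nonneg (le_max_right _ (0 : ℝ))]
  have hLp : L ^ p = c ^ p * ((r - ρ) ^ p)⁻¹ := by
    rw [hL, Real.div_rpow hc.le hrρ.le, div_eq_mul_inv]
  set X := ((r - ρ) ^ p)⁻¹ with hX
  have hX0 : 0 ≤ X := by positivity
  set W := κ / (k - h) ^ p with hW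
  have hW0 : 0 ≤ W := by positivity
  have hκa : κ * a ≤ W * Y := by
    calc κ * a ≤ κ * (Y / (k - h) ^ p) := by gcongr
      _ = W * Y := by rw [hW]; ring
  have hbr : (∫ x in S, ζ x * χ (u x) * ‖Du x‖ ^ p) + L ^ p * ∫ x in S, |ψ (u x)| ^ p ≤
      B * ((X + W) * Y) := by
    set I := ∫ x in S, |ψ (u x)| ^ p
    have hLI : L ^ p * I ≤ c ^ p * X * Y := by
      rw [hLp]
      gcongr
    have h4 : (0 : ℝ) ≤ 4 ^ (p - 1) := by positivity
    have hc4 : 0 ≤ c ^ p := by positivity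
    calc _ ≤ (2 * (4 ^ (p - 1) + 1) + 1) * (L ^ p * I) + 4 * (κ * a) := by linarith
      _ ≤ (2 * (4 ^ (p - 1) + 1) + 1) * (c ^ p * X * Y) + 4 * (W * Y) := by gcongr
      _ ≤ B * ((X + W) * Y) := by
        have p1 : 0 ≤ X * Y := by positivity
        have p2 : 0 ≤ (2 * (4 ^ (p - 1) + 1) + 1) * c ^ p * (W * Y) := by positivity
        rw [hB]
        nlinarith
  have hfac : 0 ≤ (Y / (k - h) ^ p) ^ (p / d) * (X + W) * Y := by positivity
  calc excess p u x₀ k ρ ≤ (C * p) ^ p * a ^ (p / d) * (2 ^ p * (B * ((X + W) * Y))) := by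
        refine hfirst.trans (hpoin.trans ?_)
        gcongr
        exact hgrad.trans (by gcongr)
    _ ≤ (C * p) ^ p * (Y / (k - h) ^ p) ^ (p / d) * (2 ^ p * (B * ((X + W) * Y))) := by gcongr
    _ = ((C * p) ^ p * 2 ^ p * B) * ((Y / (k - h) ^ p) ^ (p / d) * (X + W) * Y) := by ring
    _ ≤ ((C * p) ^ p * 2 ^ p * B + 1) * ((Y / (k - h) ^ p) ^ (p / d) * (X + W) * Y) := by
        gcongr
        linarith
    _ = _ := by ring

/-- Fast geometric convergence. -/
theorem exists_threshold {c b α : ℝ} (hc : 0 ≤ c) (hb : 1 < b) (hα : 0 < α) :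
    ∃ δ : ℝ, 0 < δ ∧ ∀ Z : ℕ → ℝ, (∀ j, 0 ≤ Z j) → Z 0 ≤ δ →
      (∀ j, Z (j + 1) ≤ c * b ^ j * Z j ^ α * Z j) → Tendsto Z atTop (𝓝 0) := by
  have hb0 : 0 < b := by linarith
  -- The ratio θ is chosen so that θ^α cancels b: if Z_j ≤ δθ^j, the growing factor b^j disappears
  -- from the recursion.
  set θ : ℝ := b ^ (-(1 / α)) with hθ
  have hθ0 : 0 < θ := Real.rpow_pos_of_pos hb0 _
  have hθ1 : θ < 1 := Real.rpow_lt_one_of_one_lt_of_neg hb (by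
    rw [neg_lt_zero]; positivity)
  have hθα : θ ^ α = b⁻¹ := by
    rw [hθ, ← Real.rpow_mul hb0.le, neg_mul, one_div_mul_cancel hα.ne', Real.rpow_neg_one]
  -- This makes c δ^α ≤ θ, the gain needed for the induction step; c + 1 avoids dividing by zero.
  set δ : ℝ := (θ / (c + 1)) ^ (1 / α) with hδ
  have hδ0 : 0 < δ := by positivity
  have hδα : c * δ ^ α ≤ θ := by
    rw [hδ, ← Real.rpow_mul (by positivity), one_div_mul_cancel hα.ne', Real.rpow_one,
      mul_div_assoc', div_le_iff₀ (by linarith)]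
    nlinarith
  refine ⟨δ, hδ0, fun Z hZ0 hZ hstep => ?_⟩
  have key : ∀ j, Z j ≤ δ * θ ^ j := by
    intro j
    induction j with
    | zero => simpa using hZ
    | succ j ih =>
      have h1 : Z j ^ α ≤ δ ^ α * (b⁻¹) ^ j := by
        refine (Real.rpow_le_rpow (hZ0 j) ih hα.le).trans (le_of_eq ?_)
        rw [Real.mul_rpow hδ0.le (by positivity), ← hθα, ← Real.rpow_natCast, ← Real.rpow_mul hθ0.le,
          mul_comm (j : ℝ), Real.rpow_mul hθ0.le, Real.rpow_natCast]
      calc Z (j + 1) ≤ c * b ^ j * Z j ^ α * Z j := hstep j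
        _ ≤ c * b ^ j * (δ ^ α * (b⁻¹) ^ j) * (δ * θ ^ j) := by
            have := hZ0 j
            gcongr
        _ = (c * δ ^ α) * (b * b⁻¹) ^ j * (δ * θ ^ j) := by rw [mul_pow]; ring
        _ = (c * δ ^ α) * (δ * θ ^ j) := by rw [mul_inv_cancel₀ hb0.ne', one_pow, mul_one]
        _ ≤ θ * (δ * θ ^ j) := by gcongr
        _ = δ * θ ^ (j + 1) := by ring
  refine squeeze_zero hZ0 key ?_
  simpa using (tendsto_pow_atTop_nhds_zero_of_lt_one hθ0.le hθ1).const_mul δ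

theorem integrable_norm_rpow_of_memLp {α F : Type*} [MeasurableSpace α] {μ : Measure α}
    [NormedAddCommGroup F] {p : ℝ} (hp : 0 < p) {f : α → F} (hf : MemLp f (ENNReal.ofReal p) μ) :
    Integrable (fun x => ‖f x‖ ^ p) μ := by
  have := hf.integrable_norm_rpow (by simpa using hp) ENNReal.ofReal_ne_top
  rwa [ENNReal.toReal_ofReal hp.le] at this

theorem integrable_posPart_rpow {α : Type*} [MeasurableSpace α] {μ : Measure α} {p : ℝ}
    (hp : 0 < p) {u : α → ℝ} (hu : MemLp u (ENNReal.ofReal p) μ) {l : ℝ} (hl : 0 ≤ l) :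
    Integrable (fun x => max (u x - l) 0 ^ p) μ := by
  have := integrable_norm_rpow_of_memLp hp ((isTruncation_posPart hl).memLp_comp hu)
  simpa only [Real.norm_of_nonneg (le_max_right _ (0 : ℝ))] using this

theorem excess_mono {d : ℕ} {p : ℝ} (hp : 0 < p) {u : E d → ℝ} {x₀ : E d} {h k ρ r : ℝ}
    (hu : MemLp u (ENNReal.ofReal p) (volume.restrict (ball x₀ r))) (hh : 0 ≤ h) (hk : h ≤ k)
    (hr : ρ ≤ r) : excess p u x₀ k ρ ≤ excess p u x₀ h r := by
  have hle : volume.restrict (ball x₀ ρ) ≤ volume.restrict (ball x₀ r) :=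
    Measure.restrict_mono (ball_subset_ball hr) le_rfl
  have h1 : excess p u x₀ k ρ ≤ excess p u x₀ h ρ := by
    refine integral_mono (integrable_posPart_rpow hp (hu.mono_measure hle) (hh.trans hk))
      (integrable_posPart_rpow hp (hu.mono_measure hle) hh) fun x => ?_
    exact Real.rpow_le_rpow (le_max_right _ _) (max_le_max (by linarith) le_rfl) hp.le
  exact h1.trans (setIntegral_mono_set (integrable_posPart_rpow hp hu hh)
    (.of_forall fun x => by positivity) (LE.le.eventuallyLE (ball_subset_ball hr)))

/-- The upper bound obtained from the De Giorgi iteration. -/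
theorem exists_sup_const {d : ℕ} (hd : 1 ≤ d) {p : ℝ} (hp : 1 < p) {R : ℝ} (hR : 0 < R) {κ₁ : ℝ}
    (hκ₁ : 0 ≤ κ₁) : ∃ A : ℝ, 0 < A ∧ ∀ {Ω : Set (E d)} [IsFiniteMeasure (volume.restrict Ω)]
      {K κ : ℝ} {u : E d → ℝ} {Du : E d → E d}, FluxBounded Ω p K u Du → 0 ≤ K → 0 ≤ κ →
      (∀ t : ℝ, 0 ≤ t → K * t ≤ t ^ p / 4 + κ) →
      ∀ {x₀ : E d}, closedBall x₀ R ⊆ Ω → ∀ {N : ℝ}, 0 < N → κ ≤ κ₁ * N ^ p →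
        ∫ x in ball x₀ R, ‖u x‖ ^ p ≤ N ^ p →
        ∀ᵐ x ∂volume.restrict (ball x₀ (R / 2)), u x ≤ A * N := by
  obtain ⟨C₁, hC₁, hstep⟩ := exists_deGiorgi_const hd hp
  have hp0 : 0 < p := by linarith
  have hd0 : (0 : ℝ) < d := by exact_mod_cast hd
  set α := p / d with hα
  have hα0 : 0 < α := by positivity
  set t : ℝ := 2 ^ p with ht
  have ht1 : 1 < t := Real.one_lt_rpow (by norm_num) hp0
  have ht0 : 0 < t := by linarith
  have htα : 1 < t ^ α := Real.one_lt_rpow ht1 hα0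
  -- Consecutive levels differ by k·2^{-(j+1)} and consecutive radii by R·2^{-(j+2)}. The shifts by
  -- one and two leave the extra factors `t ^ α` and `t ^ 2`.
  set c : ℝ := C₁ * ((R ^ p)⁻¹ + κ₁) * t ^ α * t ^ 2 with hc
  obtain ⟨δ, hδ0, hδ⟩ := exists_threshold (c := c) (b := t ^ α * t) (by positivity)
    (one_lt_mul_of_lt_of_le htα ht1.le) hα0
  -- The second entry brings the normalized initial excess, at most A^{-p}, below δ; the first
  -- ensures k ≥ N, so that κ / k^p ≤ κ₁.
  set A : ℝ := max 1 (δ⁻¹ ^ (1 / p)) with hA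
  have hA1 : 1 ≤ A := le_max_left _ _
  have hA0 : 0 < A := by linarith
  have hAδ : (A ^ p)⁻¹ ≤ δ := by
    rw [inv_le_comm₀ (by positivity) hδ0]
    have := Real.rpow_le_rpow (by positivity) (le_max_right 1 (δ⁻¹ ^ (1 / p))) hp0.le
    rwa [← Real.rpow_mul (by positivity), one_div_mul_cancel hp0.ne', Real.rpow_one] at this
  refine ⟨A, hA0, fun {Ω _ K κ u Du} H hK hκ0 hκ {x₀} hΩ {N} hN hκN hint => ?_⟩
  set k := A * N with hk
  have hk0 : 0 < k := by positivity
  have hkp : 0 < k ^ p := by positivity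
  have hR2 : ball x₀ R ⊆ Ω := ball_subset_closedBall.trans hΩ
  have hu : MemLp u (ENNReal.ofReal p) (volume.restrict (ball x₀ R)) :=
    H.memLp.mono_measure (Measure.restrict_mono hR2 le_rfl)
  have hur : ∀ {r}, r ≤ R → MemLp u (ENNReal.ofReal p) (volume.restrict (ball x₀ r)) := fun hr =>
    hu.mono_measure (Measure.restrict_mono (ball_subset_ball hr) le_rfl)
  set s : ℕ → ℝ := fun j => ((2 : ℝ) ^ j)⁻¹ with hs
  have hs0 : ∀ j, 0 < s j := fun j => by positivity
  have hs1 : ∀ j, s j ≤ 1 := fun j => inv_le_one_of_one_le₀ (one_le_pow₀ (by norm_num))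
  have hss : ∀ j, s (j + 1) = s j / 2 := fun j => by
    simp only [hs, pow_succ]
    field_simp
  have hsp : ∀ j, s j ^ p = (t ^ j)⁻¹ := fun j => by
    simp only [hs, ht]
    rw [Real.inv_rpow (by positivity), ← Real.rpow_natCast, ← Real.rpow_natCast,
      ← Real.rpow_mul (by norm_num), ← Real.rpow_mul (by norm_num), mul_comm]
  -- Levels rise from 0 to k while radii fall from R to R/2. The excess at (k, R/2) is below every
  -- term of the sequence, so it vanishes once they tend to zero.
  set κs : ℕ → ℝ := fun j => k * (1 - s j) with hκs
  set r : ℕ → ℝ := fun j => R / 2 * (1 + s j) with hr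
  have hrR : ∀ j, r j ≤ R := fun j => by
    simp only [hr]
    nlinarith [hs1 j]
  have hκs0 : ∀ j, 0 ≤ κs j := fun j => mul_nonneg hk0.le (by linarith [hs1 j])
  set Z : ℕ → ℝ := fun j => excess p u x₀ (κs j) (r j) / k ^ p with hZ
  have hZ0 : ∀ j, 0 ≤ Z j := fun j => div_nonneg (excess_nonneg _ _ _ _ _) hkp.le
  have hZ00 : Z 0 ≤ δ := by
    refine le_trans ?_ hAδ
    rw [div_le_iff₀ hkp, hk, Real.mul_rpow hA0.le hN.le, ← mul_assoc,
      inv_mul_cancel₀ (by positivity), one_mul]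
    refine le_trans ?_ hint
    have e1 : κs 0 = 0 := by simp [hκs, hs]
    have e2 : r 0 = R := by
      simp only [hr, hs, pow_zero, inv_one]
      ring
    rw [e1, e2]
    refine integral_mono (integrable_posPart_rpow hp0 hu le_rfl)
      (integrable_norm_rpow_of_memLp hp0 hu) fun x => ?_
    refine Real.rpow_le_rpow (le_max_right _ _) ?_ hp0.le
    rw [sub_zero]
    exact max_le (le_abs_self _) (abs_nonneg _)
  have hκk : κ / k ^ p ≤ κ₁ := by
    rw [div_le_iff₀ hkp]
    refine hκN.trans (mul_le_mul_of_nonneg_left (Real.rpow_le_rpow hN.le ?_ hp0.le) hκ₁)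
    exact le_mul_of_one_le_left hN.le hA1
  have hiter : ∀ j, Z (j + 1) ≤ c * (t ^ α * t) ^ j * Z j ^ α * Z j := fun j => by
    have e := hstep H hK hκ0 hκ (x₀ := x₀) (ρ := r (j + 1)) (r := r j) (h := κs j)
      (k := κs (j + 1)) (by have := hs0 (j + 1); positivity)
      (by simp only [hr, hss]; nlinarith [hs0 j])
      ((closedBall_subset_closedBall (hrR j)).trans hΩ) (hκs0 j)
      (by simp only [hκs, hss]; nlinarith [hs0 j])
    have d1 : κs (j + 1) - κs j = k * s (j + 1) := by
      simp only [hκs, hss]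
      ring
    have d2 : r j - r (j + 1) = R * s (j + 2) := by
      simp only [hr, hss]
      ring
    rw [d1, d2, Real.mul_rpow hk0.le (hs0 _).le, Real.mul_rpow hR.le (hs0 _).le, hsp, hsp] at e
    set Y := excess p u x₀ (κs j) (r j) with hY
    have hY0 : 0 ≤ Y := excess_nonneg _ _ _ _ _
    have hZY : Z j = Y / k ^ p := rfl
    have f1 : Y / (k ^ p * (t ^ (j + 1))⁻¹) = Z j * t ^ (j + 1) := by
      rw [hZY]
      field_simp
    have f2 : (Z j * t ^ (j + 1)) ^ α = Z j ^ α * (t ^ α) ^ (j + 1) := by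
      rw [Real.mul_rpow (hZ0 j) (by positivity), ← Real.rpow_natCast, ← Real.rpow_mul ht0.le,
        mul_comm _ α, Real.rpow_mul ht0.le, Real.rpow_natCast]
    have f3 : (R ^ p * (t ^ (j + 2))⁻¹)⁻¹ + κ / (k ^ p * (t ^ (j + 1))⁻¹) ≤
        ((R ^ p)⁻¹ + κ₁) * t ^ (j + 2) := by
      have g1 : (R ^ p * (t ^ (j + 2))⁻¹)⁻¹ = (R ^ p)⁻¹ * t ^ (j + 2) := by
        rw [mul_inv, inv_inv]
      have g2 : κ / (k ^ p * (t ^ (j + 1))⁻¹) = κ / k ^ p * t ^ (j + 1) := by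
        field_simp
      rw [g1, g2, add_mul]
      have : t ^ (j + 1) ≤ t ^ (j + 2) := pow_le_pow_right₀ ht1.le (by omega)
      gcongr
    rw [f1, f2] at e
    have hZα : 0 ≤ Z j ^ α := Real.rpow_nonneg (hZ0 j) _
    calc Z (j + 1) ≤ (C₁ * (Z j ^ α * (t ^ α) ^ (j + 1)) *
          (((R ^ p)⁻¹ + κ₁) * t ^ (j + 2)) * Y) / k ^ p := by
          refine div_le_div_of_nonneg_right (e.trans ?_) hkp.le
          gcongr
      _ = c * (t ^ α * t) ^ j * Z j ^ α * Z j := by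
          rw [hZY, hc, mul_pow]
          ring
  have hlim := hδ Z hZ0 hZ00 hiter
  have hzero : excess p u x₀ k (R / 2) = 0 := by
    refine le_antisymm ?_ (excess_nonneg _ _ _ _ _)
    have hlim2 : Tendsto (fun j => Z j * k ^ p) atTop (𝓝 0) := by
      simpa using hlim.mul_const (k ^ p)
    refine ge_of_tendsto' hlim2 fun j => ?_
    rw [hZ, div_mul_cancel₀ _ hkp.ne']
    refine excess_mono hp0 (hur (hrR j)) (hκs0 j) ?_ ?_
    · simp only [hκs]
      nlinarith [hs0 j]
    · simp only [hr]
      nlinarith [hs0 j]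
  have hae := (integral_eq_zero_iff_of_nonneg (fun x => by positivity)
    (integrable_posPart_rpow hp0 (hur (by linarith)) hk0.le)).1 hzero
  filter_upwards [hae] with x hx
  have h0 : max (u x - k) 0 = 0 := by
    by_contra hne
    exact (Real.rpow_pos_of_pos (lt_of_le_of_ne (le_max_right _ _) (Ne.symm hne)) p).ne' hx
  have := le_max_left (u x - k) 0
  linarith

/-! ### Gradient bound, two-sided estimate and choice of constants. -/

theorem integral_rpow_le_of_eLpNorm_le {α F : Type*} [MeasurableSpace α] {μ : Measure α}
    [NormedAddCommGroup F] {p : ℝ} (hp : 0 < p) {f : α → F} (hf : MemLp f (ENNReal.ofReal p) μ)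
    {N : ℝ} (hN : 0 ≤ N) (h : eLpNorm f (ENNReal.ofReal p) μ ≤ ENNReal.ofReal N) :
    ∫ x, ‖f x‖ ^ p ∂μ ≤ N ^ p := by
  have hI : 0 ≤ ∫ x, ‖f x‖ ^ p ∂μ := integral_nonneg fun x => by positivity
  rw [toReal_eLpNorm_eq hp hf, ENNReal.ofReal_le_ofReal_iff hN] at h
  have := Real.rpow_le_rpow (by positivity) h hp.le
  rwa [← Real.rpow_mul hI, inv_mul_cancel₀ hp.ne', Real.rpow_one] at this

/-- The local gradient bound. -/
theorem exists_gradient_const {d : ℕ} {p : ℝ} (hp : 1 < p) {R : ℝ} (hR : 0 < R) {κ₁ : ℝ}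
    (hκ₁ : 0 ≤ κ₁) : ∃ A : ℝ, 0 < A ∧ ∀ {Ω : Set (E d)} [IsFiniteMeasure (volume.restrict Ω)]
      {K κ : ℝ} {u : E d → ℝ} {Du : E d → E d}, FluxBounded Ω p K u Du → 0 ≤ K → 0 ≤ κ →
      (∀ t : ℝ, 0 ≤ t → K * t ≤ t ^ p / 4 + κ) →
      ∀ {x₀ : E d}, closedBall x₀ R ⊆ Ω → ∀ {N : ℝ}, 0 ≤ N → κ ≤ κ₁ * N ^ p →
        ∫ x in ball x₀ R, ‖u x‖ ^ p ≤ N ^ p →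
        eLpNorm Du (ENNReal.ofReal p) (volume.restrict (ball x₀ (R / 2))) ≤
          ENNReal.ofReal (A * N) := by
  obtain ⟨c, hc, hcut⟩ := exists_cutoff hp
  have hp0 : 0 < p := by linarith
  set L := c / (R - R / 2) with hL
  have hL0 : 0 ≤ L := div_nonneg hc.le (by linarith)
  set V := volume.real (ball (0 : E d) R) with hV
  set B := 2 * (4 ^ (p - 1) + 1) * L ^ p + 4 * κ₁ * V with hB
  have hB0 : 0 ≤ B := by positivity
  refine ⟨B ^ p⁻¹ + 1, by positivity,
    fun {Ω _ K κ u Du} H hK hκ0 hκ {x₀} hΩ {N} hN hκN hint => ?_⟩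
  obtain ⟨ζ, hζt, hζ, hζ1⟩ := hcut (half_pos hR) (half_lt_self hR) hΩ
  have hSΩ : ball x₀ R ⊆ Ω := ball_subset_closedBall.trans hΩ
  -- Without truncation the extra term is 4κ|B_R|, which κ ≤ κ₁ N^p turns into a multiple of N^p.
  have hcacc := H.caccioppoli hSΩ hp hK hκ0 hκ isTruncation_id hζt hL0 hζ
  have hDu : MemLp Du (ENNReal.ofReal p) (volume.restrict (ball x₀ R)) :=
    H.memLp_grad.mono_measure (Measure.restrict_mono hSΩ le_rfl)
  have hsub : ball x₀ (R / 2) ⊆ ball x₀ R := ball_subset_ball (by linarith)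
  have hDu2 : MemLp Du (ENNReal.ofReal p) (volume.restrict (ball x₀ (R / 2))) :=
    hDu.mono_measure (Measure.restrict_mono hsub le_rfl)
  have hvol : ∫ _ in ball x₀ R, (1 : ℝ) = V := by
    rw [setIntegral_const, smul_eq_mul, mul_one, hV, measureReal_def, measureReal_def,
      Measure.addHaar_ball_center]
  rw [hvol] at hcacc
  simp only [mul_one, id] at hcacc
  have hi : Integrable (fun x => ζ x * ‖Du x‖ ^ p) (volume.restrict (ball x₀ R)) := by
    have iD := integrable_norm_rpow_of_memLp hp0 hDu
    refine iD.mono (hζt.contDiff_one.continuous.aestronglyMeasurable.mul iD.1)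
      (.of_forall fun x => ?_)
    rw [norm_mul, Real.norm_of_nonneg (hζ.nonneg x)]
    exact mul_le_of_le_one_left (norm_nonneg _) (hζ.le_one x)
  have hmain : ∫ x in ball x₀ (R / 2), ‖Du x‖ ^ p ≤ B * N ^ p := by
    calc ∫ x in ball x₀ (R / 2), ‖Du x‖ ^ p = ∫ x in ball x₀ (R / 2), ζ x * ‖Du x‖ ^ p :=
          setIntegral_congr_fun measurableSet_ball fun x hx => by simp only [hζ1 x hx, one_mul]
      _ ≤ ∫ x in ball x₀ R, ζ x * ‖Du x‖ ^ p := setIntegral_mono_set hi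
          (.of_forall fun x => mul_nonneg (hζ.nonneg x) (by positivity))
          (LE.le.eventuallyLE hsub)
      _ ≤ 2 * (4 ^ (p - 1) + 1) * L ^ p * N ^ p + 4 * (κ₁ * N ^ p) * V := by
          refine hcacc.trans ?_
          have hint' : ∫ x in ball x₀ R, |u x| ^ p ≤ N ^ p := hint
          gcongr
      _ = B * N ^ p := by rw [hB]; ring
  rw [toReal_eLpNorm_eq hp0 hDu2]
  refine ENNReal.ofReal_le_ofReal ((Real.rpow_le_rpow (integral_nonneg fun x => by positivity)
    hmain (by positivity)).trans ?_)
  rw [Real.mul_rpow hB0 (by positivity), ← Real.rpow_mul hN, mul_inv_cancel₀ hp0.ne', Real.rpow_one]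
  gcongr
  linarith

theorem exists_local_const {d : ℕ} (hd : 1 ≤ d) {p : ℝ} (hp : 1 < p) {R : ℝ} (hR : 0 < R) {κ₁ : ℝ}
    (hκ₁ : 0 ≤ κ₁) : ∃ A : ℝ, 0 < A ∧ ∀ {Ω : Set (E d)} [IsFiniteMeasure (volume.restrict Ω)]
      {K κ : ℝ} {u : E d → ℝ} {Du : E d → E d}, FluxBounded Ω p K u Du → 0 ≤ K → 0 ≤ κ →
      (∀ t : ℝ, 0 ≤ t → K * t ≤ t ^ p / 4 + κ) →
      ∀ {x₀ : E d}, closedBall x₀ R ⊆ Ω → ∀ {N : ℝ}, 0 ≤ N → κ ≤ κ₁ * N ^ p →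
        eLpNorm u (ENNReal.ofReal p) (volume.restrict (ball x₀ R)) ≤ ENNReal.ofReal N →
        eLpNorm u ⊤ (volume.restrict (ball x₀ (R / 2))) ≤ ENNReal.ofReal (A * N) ∧
        eLpNorm Du (ENNReal.ofReal p) (volume.restrict (ball x₀ (R / 2))) ≤
          ENNReal.ofReal (A * N) := by
  obtain ⟨A₁, hA₁, hsup⟩ := exists_sup_const hd hp hR hκ₁
  obtain ⟨A₂, hA₂, hgrad⟩ := exists_gradient_const (d := d) hp hR hκ₁
  have hp0 : 0 < p := by linarith
  refine ⟨A₁ + A₂, by positivity,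
    fun {Ω _ K κ u Du} H hK hκ0 hκ {x₀} hΩ {N} hN hκN hle => ?_⟩
  have hu : MemLp u (ENNReal.ofReal p) (volume.restrict (ball x₀ R)) :=
    H.memLp.mono_measure (Measure.restrict_mono (ball_subset_closedBall.trans hΩ) le_rfl)
  have hint := integral_rpow_le_of_eLpNorm_le hp0 hu hN hle
  refine ⟨?_, (hgrad H hK hκ0 hκ hΩ hN hκN hint).trans (ENNReal.ofReal_le_ofReal (by nlinarith))⟩
  -- The iteration divides by powers of A N and needs N > 0; if N = 0, then u vanishes almost
  -- everywhere on the ball.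
  rcases hN.eq_or_lt with rfl | hN0
  · rw [ENNReal.ofReal_zero, nonpos_iff_eq_zero,
      eLpNorm_eq_zero_iff hu.1 (by simpa using hp0)] at hle
    have h0 : u =ᵐ[volume.restrict (ball x₀ (R / 2))] 0 :=
      ae_mono (Measure.restrict_mono (ball_subset_ball (by linarith)) le_rfl) hle
    rw [eLpNorm_congr_ae h0]
    simp
  · have hint' : ∫ x in ball x₀ R, ‖-u x‖ ^ p ≤ N ^ p := by simpa only [norm_neg] using hint
    rw [eLpNorm_exponent_top]
    refine essSup_le_of_ae_le _ ?_
    filter_upwards [hsup H hK hκ0 hκ hΩ hN0 hκN hint,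
      hsup H.neg hK hκ0 hκ hΩ hN0 hκN hint'] with x h1 h2
    rw [← ofReal_norm]
    refine ENNReal.ofReal_le_ofReal ?_
    have h3 : 0 ≤ A₂ * N := by positivity
    rw [Real.norm_eq_abs, abs_le]
    constructor <;> nlinarith

end Transmission

theorem theorem3p1 (d : ℕ) (hd : 1 ≤ d) (p : ℝ) (hp : 2 < p)
    (Ω₁ : Set (Transmission.E d)) (hΩ₁ : IsOpen Ω₁)
    (hΓ : Transmission.IsC1Hypersurface (frontier Ω₁))
    (R : ℝ) (hR : 0 < R) (M : ℝ≥0) :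
    ∃ C : ℝ, 0 < C ∧
      ∀ Ω : Set (Transmission.E d), IsOpen Ω → IsConnected Ω → Bornology.IsBounded Ω →
        closure Ω₁ ⊆ Ω →
      ∀ f : Transmission.E d → ℝ,
        MemLp f ∞ (Transmission.surfaceMeasure (frontier Ω₁)) →
        eLpNorm f ∞ (Transmission.surfaceMeasure (frontier Ω₁)) = (M : ℝ≥0∞) →
      ∀ (u : Transmission.E d → ℝ) (Du : Transmission.E d → Transmission.E d),
        Transmission.IsWeakSolution Ω (frontier Ω₁) p f u Du →
      ∀ x₀ : Transmission.E d, closedBall x₀ R ⊆ Ω →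
        eLpNorm u ∞ (volume.restrict (ball x₀ (R / 2))) ≤
          ENNReal.ofReal (C * R ^ (-(d : ℝ) / p)) *
            (eLpNorm u (ENNReal.ofReal p) (volume.restrict (ball x₀ R)) +
              ENNReal.ofReal (R ^ ((d : ℝ) / p + 1)) *
                eLpNorm f ∞ (Transmission.surfaceMeasure (frontier Ω₁))) ∧
        eLpNorm Du (ENNReal.ofReal p) (volume.restrict (ball x₀ (R / 2))) ≤
          ENNReal.ofReal (C * R⁻¹) *
            (eLpNorm u (ENNReal.ofReal p) (volume.restrict (ball x₀ R)) +
              ENNReal.ofReal (R ^ ((d : ℝ) / p + 1)) *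
                eLpNorm f ∞ (Transmission.surfaceMeasure (frontier Ω₁))) := by

  have hp1 : 1 < p := by linarith
  -- If the interface is not compact, no bounded Ω contains the closure of Ω₁, and any constant
  -- works.
  by_cases hc : IsCompact (frontier Ω₁)
  swap
  · refine ⟨1, one_pos, fun Ω _ _ hb hsub => ?_⟩
    exact absurd (isCompact_of_isClosed_isBounded isClosed_frontier
      ((hb.subset hsub).subset frontier_subset_closure)) hc
  obtain ⟨CΓ, hCΓ⟩ := hΓ.trace_inequality hd hc
  have hfin := Transmission.isFiniteMeasure_surfaceMeasure hd hΓ hc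
  have hK : (0 : ℝ) ≤ M * CΓ := by positivity
  obtain ⟨κ, hκ0, hκK, hκ⟩ := Transmission.exists_young_const hp1 hK
  set m : ℝ := R ^ ((d : ℝ) / p + 1) * M with hm
  have hRpos : 0 < R ^ ((d : ℝ) / p + 1) := Real.rpow_pos_of_pos hR _
  have hm0 : 0 ≤ m := by positivity
  -- Thus κ₁ = κ / m^p is admissible for every N ≥ m. If M = 0 then m = 0 and the quotient is a
  -- division by zero, harmless because κ = 0.
  have hκm : κ ≤ κ / m ^ p * m ^ p := by
    rcases eq_or_ne M 0 with rfl | hM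
    · rw [hκK (by simp)]
      simp
    · have : 0 < m := mul_pos hRpos (by exact_mod_cast pos_iff_ne_zero.2 hM)
      rw [div_mul_cancel₀ _ (Real.rpow_pos_of_pos this p).ne']
  have hκ₁ : 0 ≤ κ / m ^ p := by positivity
  obtain ⟨A, hA, hloc⟩ := Transmission.exists_local_const hd hp1 hR hκ₁
  have hRd : 0 < R ^ ((d : ℝ) / p) := Real.rpow_pos_of_pos hR _
  -- The sum makes both C R^{-d/p} and C R^{-1} at least A, so one constant serves both estimates.
  refine ⟨A * (R ^ ((d : ℝ) / p) + R), by positivity, ?_⟩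
  intro Ω _ _ hb _ f _ hf u Du hu x₀ hball
  have hfinΩ : IsFiniteMeasure (volume.restrict Ω) := ⟨by
    rw [Measure.restrict_apply_univ]
    exact hb.measure_lt_top⟩
  have H : Transmission.FluxBounded Ω p (M * CΓ) u Du :=
    ⟨hu.1.1.memLp, hu.1.1.memLp_grad, hu.1.2, fun φ hφ => hu.abs_integral_flux_le hCΓ hf.le hφ⟩
  have huB : MemLp u (ENNReal.ofReal p) (volume.restrict (ball x₀ R)) :=
    hu.1.1.memLp.mono_measure
      (Measure.restrict_mono (ball_subset_closedBall.trans hball) le_rfl)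
  set n : ℝ := (eLpNorm u (ENNReal.ofReal p) (volume.restrict (ball x₀ R))).toReal with hn
  have hn0 : 0 ≤ n := ENNReal.toReal_nonneg
  have hnu : eLpNorm u (ENNReal.ofReal p) (volume.restrict (ball x₀ R)) = ENNReal.ofReal n :=
    (ENNReal.ofReal_toReal huB.2.ne).symm
  have hN0 : 0 ≤ n + m := by positivity
  have hκN : κ ≤ κ / m ^ p * (n + m) ^ p := hκm.trans
    (mul_le_mul_of_nonneg_left (Real.rpow_le_rpow hm0 (by linarith) (by linarith)) hκ₁)
  obtain ⟨h1, h2⟩ := hloc H hK hκ0 hκ hball hN0 hκN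
    (hnu.le.trans (ENNReal.ofReal_le_ofReal (by linarith)))
  have hrhs : eLpNorm u (ENNReal.ofReal p) (volume.restrict (ball x₀ R)) +
      ENNReal.ofReal (R ^ ((d : ℝ) / p + 1)) *
        eLpNorm f ∞ (Transmission.surfaceMeasure (frontier Ω₁)) = ENNReal.ofReal (n + m) := by
    rw [hf, hnu, ← ENNReal.ofReal_coe_nnreal, ← ENNReal.ofReal_mul hRpos.le,
      ← ENNReal.ofReal_add hn0 hm0]
  rw [hrhs, ← ENNReal.ofReal_mul (by positivity), ← ENNReal.ofReal_mul (by positivity)]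
  refine ⟨h1.trans (ENNReal.ofReal_le_ofReal (mul_le_mul_of_nonneg_right ?_ hN0)),
    h2.trans (ENNReal.ofReal_le_ofReal (mul_le_mul_of_nonneg_right ?_ hN0))⟩
  · rw [neg_div, Real.rpow_neg hR.le, mul_assoc]
    refine le_mul_of_one_le_right hA.le ?_
    rw [← div_eq_mul_inv, one_le_div hRd]
    linarith
  · rw [mul_assoc]
    refine le_mul_of_one_le_right hA.le ?_
    rw [← div_eq_mul_inv, one_le_div hR]
    linarith
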